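/- **Theorem.** Let $\kappa$ be a weakly compact cardinal, i.e. $\kappa$ is uncountable and $\kappa\to(\kappa)^2_2$. Then the following statements are equivalent for every partial order $\mathbb{P}$: 1. $\mathbb{P}$ satisfies the $\kappa$-chain condition: every antichain (set of pairwise incompatible conditions) in $\mathbb{P}$ has cardinality less than $\kappa$. 2. $\mathbb{P}$ is $\kappa$-Knaster: every set of $\kappa$ many conditions in $\mathbb{P}$ has a subset of cardinality $\kappa$ consisting of pairwise compatible conditions. 3. $\mathbb{P}$ is $\kappa$-stationarily layered: $\mathrm{Reg}_\kappa(\mathbb{P})$ is stationary in $\mathcal{P}_\kappa(\mathbb{P})$. 4. $\mathbb{P}$ is completely $\mathcal{F}_{wc(\kappa)}$-layered: every subset of $\mathbb{P}$ of cardinality at most $\kappa$ is contained in a regular suborder of $\mathbb{P}$ of cardinality at most $\kappa$, and every regular suborder of $\mathbb{P}$ of cardinality at most $\kappa$ is $\mathcal{F}_{wc(\kappa)}$-layered. Here the following notions are used. * $\mathcal{P}_\kappa(A)$ is the set of all subsets of $A$ of cardinality less than $\kappa$. A set $S\subseteq\mathcal{P}_\kappa(A)$ is *stationary* in $\mathcal{P}_\kappa(A)$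 if it meets every $C\subseteq\mathcal{P}_\kappa(A)$ that is $\subseteq$-cofinal in $\mathcal{P}_\kappa(A)$ and closed under unions of nonempty $\subseteq$-chains of length less than $\kappa$. * A subset $\mathbb{Q}\subseteq\mathbb{P}$ with the induced order is a *regular suborder* of $\mathbb{P}$ if conditions that are incompatible in $\mathbb{Q}$ are incompatible in $\mathbb{P}$ and every maximal antichain in $\mathbb{Q}$ is a maximal antichain in $\mathbb{P}$. $\mathrm{Reg}_\kappa(\mathbb{P})$ is the set of all regular suborders of $\mathbb{P}$ of cardinality less than $\kappa$. * For a filter $\mathcal{F}$ on $\mathcal{P}_\kappa(\kappa)$, a partial order $\mathbb{Q}$ is *$\mathcal{F}$-layered* if $|\mathbb{Q}|\leq\kappa$ and $\{a\in\mathcal{P}_\kappa(\kappa)\mid s[a]\in\mathrm{Reg}_\kappa(\mathbb{Q})\}\in\mathcal{F}$ for every surjection $s:\kappa\to\mathbb{Q}$. * The *weakly compact filter* $\mathcal{F}_{wc(\kappa)}$ is the filter on $\mathcal{P}_\kappa(\kappa)$ generated by the sets $$R_{\Phi,A,a}=\{\alpha<\kappa\mid a\in V_\alpha,\ V_\alpha\models\Phi(A\cap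 V_\alpha,a)\}\subseteq\mathcal{P}_\kappa(\kappa),$$ where $\Phi(X,x)$ is a $\Pi^1_1$-formula (a block of universal quantifiers over subsets of the domain followed by a first-order formula in the language of set theory with these subsets and $X$ as predicates), $A\subseteq V_\kappa$, $a\in V_\kappa$ and $V_\kappa\models\Phi(A,a)$. -/

import Mathlib

open Cardinal

universe u

namespace Layering

/-! ### Partial orders and chain conditions -/

section Orders

variable {P : Type u} [Preorder P]

/-- Two conditions are compatible if they have a common extension. -/
def Compatible (p q : P) : Prop :=
  ∃ r : P, r ≤ p ∧ r ≤ q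

/-- `Q` is a regular suborder of `P`: the inclusion of `Q` (with the induced order) into `P`
preserves incompatibility and maps maximal antichains of `Q` to maximal antichains of `P`. -/
def IsRegularSuborder (Q : Set P) : Prop :=
  (∀ p q : Q, ¬ Compatible p q → ¬ Compatible (p : P) (q : P)) ∧
    ∀ A : Set Q, IsMaxAntichain Compatible A → IsMaxAntichain Compatible (Subtype.val '' A : Set P)

end Orders

/-- The collection of all regular suborders of `P` of cardinality less than `κ`. -/
def Reg (κ : Cardinal.{u}) (P : Type u) [Preorder P] : Set (Set P) :=
  {Q | IsRegularSuborder Q ∧ #Q < κ}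

/-- The `κ`-chain condition: antichains (sets of pairwise incompatible conditions) have cardinality
less than `κ`. -/
def ChainCondition (κ : Cardinal.{u}) (P : Type u) [Preorder P] : Prop :=
  ∀ A : Set P, IsAntichain Compatible A → #A < κ

/-- The `κ`-Knaster property. -/
def IsKnaster (κ : Cardinal.{u}) (P : Type u) [Preorder P] : Prop :=
  ∀ S : Set P, #S = κ → ∃ T ⊆ S, #T = κ ∧ ∀ p ∈ T, ∀ q ∈ T, Compatible p q

/-! ### Stationarity in `P_κ(A)` in the sense of Jech -/

/-- `P_κ(A)`, the set of all subsets of `A` of cardinality less than `κ`, ordered by inclusion. -/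
abbrev Pk (κ : Cardinal.{u}) (A : Type u) : Type u :=
  {a : Set A // #a < κ}

/-- Closed and cofinal subsets of `P_κ(A)`: closed means closed under unions of nonempty
`⊆`-chains of length less than `κ`. -/
structure IsClubPk {κ : Cardinal.{u}} {A : Type u} (C : Set (Pk κ A)) : Prop where
  closed : ∀ D : Set (Pk κ A), D ⊆ C → D.Nonempty → IsChain (· ≤ ·) D → #D < κ →
    ∀ x : Pk κ A, (x : Set A) = ⋃ d ∈ D, (d : Set A) → x ∈ C
  cofinal : ∀ a : Pk κ A, ∃ c ∈ C, a ≤ c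

/-- Stationary subsets of `P_κ(A)`. -/
def IsStationaryPk {κ : Cardinal.{u}} {A : Type u} (S : Set (Pk κ A)) : Prop :=
  ∀ C : Set (Pk κ A), IsClubPk C → (S ∩ C).Nonempty

/-- `P` is `κ`-stationarily layered. -/
def StationarilyLayered (κ : Cardinal.{u}) (P : Type u) [Preorder P] : Prop :=
  IsStationaryPk {a : Pk κ P | (a : Set P) ∈ Reg κ P}

/-! ### Layering with respect to a filter on `P_κ(l)` -/

/-- `P` is `F`-layered, where `F` is a filter on `P_κ(l)` and the cardinal `l` is represented by the
well-order `l.ord.ToType` of order type `l`. -/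
def FLayered {κ l : Cardinal.{u}} (F : Filter (Pk κ l.ord.ToType)) (P : Type u) [Preorder P] :
    Prop :=
  #P ≤ l ∧ ∀ s : l.ord.ToType → P, Function.Surjective s →
    {a : Pk κ l.ord.ToType | s '' (a : Set l.ord.ToType) ∈ Reg κ P} ∈ F

/-- `P` is completely `F`-layered, where `F` is a filter on `P_κ(l)`. -/
def CompletelyFLayered {κ l : Cardinal.{u}} (F : Filter (Pk κ l.ord.ToType)) (P : Type u)
    [Preorder P] : Prop :=
  (∀ S : Set P, #S ≤ l → ∃ Q : Set P, S ⊆ Q ∧ IsRegularSuborder Q ∧ #Q ≤ l) ∧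
    ∀ Q : Set P, IsRegularSuborder Q → #Q ≤ l → FLayered F Q

/-! ### `Π¹₁`-formulas and the weakly compact filter -/

/-- Relation symbols: membership, a predicate for the second-order parameter, and `n` set
variables. -/
inductive SetRel (n : ℕ) : ℕ → Type
  | mem : SetRel n 2
  | param : SetRel n 1
  | var (i : Fin n) : SetRel n 1

/-- The first-order language of set theory with `n + 1` additional unary predicates. -/
def setLang (n : ℕ) : FirstOrder.Language.{0, 0} :=
  ⟨fun _ => Empty, SetRel n⟩

/-- The interpretation of `setLang n` given by a membership relation `E`, a second-order parameter
`A` and values `X` of the set variables. -/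
@[reducible] def setStructure {M : Type*} (E : M → M → Prop) (A : Set M) {n : ℕ}
    (X : Fin n → Set M) : (setLang n).Structure M where
  funMap := fun f => Empty.elim f
  RelMap := fun r => match r with
    | .mem => fun v => E (v 0) (v 1)
    | .param => fun v => v 0 ∈ A
    | .var i => fun v => v 0 ∈ X i

/-- A `Π¹₁`-formula `∀ X₀ … ∀ Xₙ₋₁ φ` with one free second-order variable and one free
first-order variable; `φ` has first-order quantifiers only. -/
structure Pi11Formula where
  /-- The number of universally quantified set variables. -/
  numVars : ℕ
  /-- The first-order part. -/
  matrix : (setLang numVars).Formula Unit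

/-- Satisfaction of a `Π¹₁`-formula in `(M, E)`, set variables ranging over all subsets of `M`. -/
def Pi11Formula.Realize {M : Type*} (E : M → M → Prop) (Φ : Pi11Formula) (A : Set M) (a : M) :
    Prop :=
  ∀ X : Fin Φ.numVars → Set M,
    @FirstOrder.Language.Formula.Realize (setLang Φ.numVars) M (setStructure E A X) Unit Φ.matrix
      (fun _ => a)

open ZFSet in
/-- `a ∈ V_α` and `V_α ⊨ Φ(A ∩ V_α, a)`. -/
def VSat (α : Ordinal.{u}) (Φ : Pi11Formula) (A : Set ZFSet.{u}) (a : ZFSet.{u}) : Prop :=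
  ∃ ha : a ∈ V_ α, Φ.Realize (M := {x : ZFSet.{u} // x ∈ V_ α})
    (fun x y => (x : ZFSet.{u}) ∈ (y : ZFSet.{u})) {x | (x : ZFSet.{u}) ∈ A} ⟨a, ha⟩

/-- The ordinal `α`, i.e. the set of all ordinals less than `α`, as a subset of (the well-order
representing) `κ`. -/
def initialSeg (κ : Cardinal.{u}) (α : Ordinal.{u}) : Set κ.ord.ToType :=
  {x | (Ordinal.ToType.toOrd x : Ordinal.{u}) < α}

/-- The set `{α < κ | V_α ⊨ Φ(A ∩ V_α, a)}`, viewed as a subset of `P_κ(κ)`. -/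
def reflectionSet (κ : Cardinal.{u}) (Φ : Pi11Formula) (A : Set ZFSet.{u}) (a : ZFSet.{u}) :
    Set (Pk κ κ.ord.ToType) :=
  {x | ∃ α < κ.ord, VSat α Φ A a ∧ (x : Set κ.ord.ToType) = initialSeg κ α}

open ZFSet in
/-- The weakly compact filter on `P_κ(κ)`: the filter generated by the sets
`{α < κ | V_α ⊨ Φ(A ∩ V_α, a)}`, where `Φ` is a `Π¹₁`-formula, `A ⊆ V_κ`, `a ∈ V_κ` and
`V_κ ⊨ Φ(A, a)`. -/
def wcFilter (κ : Cardinal.{u}) : Filter (Pk κ κ.ord.ToType) :=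
  Filter.generate {R | ∃ (Φ : Pi11Formula) (A : Set ZFSet.{u}) (a : ZFSet.{u}),
    (∀ x ∈ A, x ∈ V_ κ.ord) ∧ a ∈ V_ κ.ord ∧ VSat κ.ord Φ A a ∧ R = reflectionSet κ Φ A a}

/-! ### Weakly compact cardinals -/

/-- `κ` is weakly compact: it is uncountable and satisfies the partition relation `κ → (κ)²₂`,
i.e. every colouring of the pairs `x < y` of elements of `κ` with two colours has a homogeneous set
of cardinality `κ`. -/
def IsWeaklyCompact (κ : Cardinal.{u}) : Prop :=
  ℵ₀ < κ ∧ ∀ c : κ.ord.ToType → κ.ord.ToType → Bool,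
    ∃ H : Set κ.ord.ToType, #H = κ ∧ ∃ i : Bool, ∀ x ∈ H, ∀ y ∈ H, x < y → c x y = i

end Layering

namespace Layering

/-! ### Sets of size `κ` in the well-order of type `κ` -/

/-! The chain condition is the hub. Colouring pairs by compatibility gives the Knaster property, and
a Knaster order has no antichain of size `κ`. Either form of layering gives the chain condition
back: a regular suborder that contains, for each of its elements, a compatible member of a maximal
antichain `B` must contain all of `B` (`IsRegularSuborder.antichain_subset`), so `B` is small.

The substance lies in deriving layering (`ChainCondition.reg_mem_wcFilter`). Enumerate an order with
the chain condition by `s : κ → Q`. Maximal antichains are bounded in index, which is a `Π¹₁`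
statement about `V_κ`, so it reflects to many `α`. A maximal antichain of `s[α]` then lies in `s[δ]`
for some `δ < α`. If `α` is closed under adding witnesses, a failure of maximality in `Q` would
already be visible in `s[α]`. Orders of arbitrary size are handled by chains of small sets whose
union is regular (`exists_regular_chain`).

Stationarity, and recovering the chain condition from layering, need the weakly compact filter to be
proper, i.e. `Π¹₁`-reflection must be derived from the partition relation. The lexicographic
colouring yields a `κ`-complete filter deciding `κ` many sets (`IsWeaklyCompact.exists_filter`). A
minimal pushforward of it makes `κ` many regressive functions constant
(`IsWeaklyCompact.exists_regressive_filter`). Among these are Skolem functions for the structures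
`V_x` with putative counterexamples to the formulas. A Łoś argument (`eventually_sat_iff`) then
transfers a counterexample from almost all `V_x` to `V_κ`. -/

theorem mk_Iio_toType_lt {κ : Cardinal.{u}} (d : κ.ord.ToType) : #(Set.Iio d) < κ := by
  simpa using mk_Iio_lt d (by simp)

theorem exists_gt_of_mk_eq {κ : Cardinal.{u}} {H : Set κ.ord.ToType} (hH : #H = κ)
    (d : κ.ord.ToType) : ∃ x ∈ H, d ≤ x := by
  by_contra! h
  have : #H ≤ #(Set.Iio d) := mk_le_mk_of_subset h
  exact absurd (this.trans_lt (mk_Iio_toType_lt d)) (by rw [hH]; exact lt_irrefl _)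

theorem exists_bound {κ : Cardinal.{u}} (hr : κ.IsRegular) {ι : Type u} (hι : #ι < κ)
    (b : ι → κ.ord.ToType) : ∃ d, ∀ i, b i < d := by
  by_contra! h
  have hcof : IsCofinal (Set.range b) := fun d => by
    obtain ⟨i, hi⟩ := h d
    exact ⟨b i, ⟨i, rfl⟩, hi⟩
  have h1 := (Order.cof_le hcof).trans mk_range_le
  rw [Ordinal.cof_toType, hr.cof_ord] at h1
  exact absurd hι h1.not_gt

theorem mk_lt_of_bounded {κ : Cardinal.{u}} {H : Set κ.ord.ToType}
    {d : κ.ord.ToType} (h : ∀ x ∈ H, x < d) : #H < κ :=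
  (mk_le_mk_of_subset h).trans_lt (mk_Iio_toType_lt d)

theorem exists_gt {κ : Cardinal.{u}} (hr : κ.IsRegular) (d : κ.ord.ToType) : ∃ e, d < e := by
  have : #PUnit.{u+1} < κ := by simpa using one_lt_aleph0.trans_le hr.aleph0_le
  obtain ⟨e, he⟩ := exists_bound hr this fun _ => d
  exact ⟨e, he ⟨⟩⟩

/-! ### Weakly compact cardinals are inaccessible -/

/-- Send each point to an upper bound in a cofinal set of size less than `κ` and colour pairs by
equality of these bounds. One kind of homogeneous set would be bounded, the other would inject into
the cofinal set. -/
theorem IsWeaklyCompact.isRegular {κ : Cardinal.{u}} (hκ : IsWeaklyCompact κ) :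
    κ.IsRegular := by
  classical
  refine ⟨hκ.1.le, ?_⟩
  by_contra! hlt
  rw [← Ordinal.cof_toType] at hlt
  obtain ⟨s, hs, hs'⟩ := Order.exists_cof_eq κ.ord.ToType
  choose p hp hp' using hs
  obtain ⟨H, hH, i, hi⟩ := hκ.2 fun x y => decide (p x = p y)
  cases i with
  | true =>
    have hne : H.Nonempty := by
      rw [← Set.nonempty_coe_sort, ← mk_ne_zero_iff, hH]
      exact (aleph0_pos.trans hκ.1).ne'
    obtain ⟨x, hx⟩ := hne
    have hb : H ⊆ Set.Iic (p x) := fun y hy => by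
      have : p y = p x := by
        rcases lt_trichotomy x y with h | h | h
        · simpa using (of_decide_eq_true (hi x hx y hy h)).symm
        · rw [h]
        · simpa using of_decide_eq_true (hi y hy x hx h)
      exact this ▸ hp' y
    have h1 : #H ≤ #(Set.Iic (p x)) := mk_le_mk_of_subset hb
    have h2 : #(Set.Iic (p x)) < κ := by
      rw [← Set.Iio_insert]
      refine mk_insert_le.trans_lt (add_lt_of_lt hκ.1.le (mk_Iio_toType_lt _) ?_)
      exact one_lt_aleph0.trans hκ.1
    exact absurd (h1.trans_lt h2) (by rw [hH]; exact lt_irrefl _)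
  | false =>
    have hinj : Function.Injective (fun x : H => (⟨p x, hp x⟩ : s)) := by
      rintro ⟨x, hx⟩ ⟨y, hy⟩ hxy
      simp only [Subtype.mk.injEq] at hxy ⊢
      rcases lt_trichotomy x y with h | h | h
      · exact absurd hxy (of_decide_eq_false (hi x hx y hy h))
      · exact h
      · exact absurd hxy.symm (of_decide_eq_false (hi y hy x hx h))
    have := mk_le_of_injective hinj
    rw [hH, hs'] at this
    exact absurd hlt this.not_gt

/-- A sequence of binary sequences that is monotone for the lexicographic order (or its reverse) is
eventually constant in each coordinate. -/
theorem exists_eventuallyConst_of_lex {κ : Cardinal.{u}} (hr : κ.IsRegular)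
    (s : κ.ord.ToType → κ.ord.ToType → Bool) {H : Set κ.ord.ToType} (top : Bool)
    (h : ∀ x ∈ H, ∀ y ∈ H, x < y → ∀ i, (∀ j < i, s x j = s y j) → s x i = top → s y i = top)
    (i : κ.ord.ToType) : ∃ c : Bool, ∃ b : κ.ord.ToType, ∀ x ∈ H, b ≤ x → s x i = c := by
  induction i using WellFoundedLT.induction with
  | _ i ih =>
    choose c b hb using ih
    obtain ⟨d, hd⟩ := exists_bound hr (mk_Iio_toType_lt i) fun j : Set.Iio i => b j.1 j.2
    -- Past `d` all coordinates below `i` are constant, so coordinate `i` can only move towards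
    -- `top`: once attained, that value persists.
    by_cases hx : ∃ x ∈ H, d ≤ x ∧ s x i = top
    · obtain ⟨x, hxH, hdx, hxt⟩ := hx
      refine ⟨top, x, fun y hy hxy => ?_⟩
      rcases hxy.eq_or_lt with rfl | hlt
      · exact hxt
      · refine h x hxH y hy hlt i (fun j hj => ?_) hxt
        rw [hb j hj x hxH ((hd ⟨j, hj⟩).le.trans hdx),
          hb j hj y hy ((hd ⟨j, hj⟩).le.trans (hdx.trans hxy))]
    · push Not at hx
      exact ⟨!top, d, fun y hy hdy => by simpa [Bool.eq_not_iff] using hx y hy hdy⟩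

/-- Colour `x < y` by whether `s x` is lexicographically at most `s y`. Either colour makes the
sequence monotone along `H`, in the order or in its reverse. -/
theorem IsWeaklyCompact.exists_eventuallyConst {κ : Cardinal.{u}} (hκ : IsWeaklyCompact κ)
    (s : κ.ord.ToType → κ.ord.ToType → Bool) :
    ∃ H : Set κ.ord.ToType, #H = κ ∧
      ∀ i, ∃ c : Bool, ∃ b : κ.ord.ToType, ∀ x ∈ H, b ≤ x → s x i = c := by
  classical
  obtain ⟨H, hH, ε, hε⟩ := hκ.2 fun x y =>
    decide (∀ i, (∀ j < i, s x j = s y j) → s x i = true → s y i = true)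
  refine ⟨H, hH, exists_eventuallyConst_of_lex hκ.isRegular s ε fun x hx y hy hxy => ?_⟩
  have := hε x hx y hy hxy
  cases ε with
  | true => simpa using this
  | false =>
    -- Here the first difference between `s x` and `s y` is a drop from `true` to `false`, so the
    -- value that persists is `false`.
    rw [decide_eq_false_iff_not] at this
    push Not at this
    obtain ⟨i, hi, hxi, hyi⟩ := this
    intro k hk hxk
    rcases lt_trichotomy i k with h | h | h
    · exact absurd ((hk i h).symm.trans hxi) hyi
    · subst h; simp [hxi] at hxk
    · rw [← hi k h, hxk]

/-- For the strong limit property, list `κ` many distinct functions `ι → Bool` with `#ι < κ`. By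
regularity all coordinates stabilise below a common bound, so two different members of the list
coincide. -/
theorem IsWeaklyCompact.isInaccessible {κ : Cardinal.{u}} (hκ : IsWeaklyCompact κ) :
    κ.IsInaccessible := by
  classical
  refine ⟨hκ.1, hκ.isRegular.cof_ord.ge, fun x hx => ?_⟩
  by_contra! hle
  induction x using Cardinal.inductionOn with
  | _ ι =>
  obtain ⟨e⟩ : Nonempty (ι ↪ κ.ord.ToType) := by
    rw [← Cardinal.le_def, mk_ord_toType]; exact hx.le
  obtain ⟨f⟩ : Nonempty (κ.ord.ToType ↪ (ι → Bool)) := by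
    rw [← Cardinal.le_def, mk_ord_toType]; simpa using hle
  obtain ⟨H, hH, h⟩ := hκ.exists_eventuallyConst
    fun x i => Function.extend e (f x) (fun _ => false) i
  choose c b hb using h
  obtain ⟨d, hd⟩ := exists_bound hκ.isRegular hx fun k => b (e k)
  have hval : ∀ x ∈ H, d ≤ x → f x = c ∘ e := fun x hx hdx => by
    funext k
    have := hb (e k) x hx ((hd k).le.trans hdx)
    rwa [e.injective.extend_apply] at this
  obtain ⟨x, hx, hdx⟩ := exists_gt_of_mk_eq hH d
  obtain ⟨x', hx'⟩ := exists_gt hκ.isRegular x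
  obtain ⟨y, hy, hxy⟩ := exists_gt_of_mk_eq hH x'
  have hlt := hx'.trans_le hxy
  exact hlt.ne (f.injective ((hval x hx hdx).trans (hval y hy (hdx.trans hlt.le)).symm))

/-- A `κ`-complete filter containing all final segments and deciding `κ` many given sets. -/
theorem IsWeaklyCompact.exists_filter {κ : Cardinal.{u}} (hκ : IsWeaklyCompact κ)
    {I : Type u} (hI : #I ≤ κ) (S : I → Set κ.ord.ToType) :
    ∃ U : Filter κ.ord.ToType, U.NeBot ∧
      (∀ {ι : Type u} (p : ι → κ.ord.ToType → Prop), #ι < κ → (∀ i, ∀ᶠ x in U, p i x) →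
        ∀ᶠ x in U, ∀ i, p i x) ∧
      (∀ d, ∀ᶠ x in U, d < x) ∧ ∀ i, (∀ᶠ x in U, x ∈ S i) ∨ ∀ᶠ x in U, x ∉ S i := by
  classical
  have hr := hκ.isRegular
  obtain ⟨e⟩ : Nonempty (I ↪ κ.ord.ToType) := by rw [← Cardinal.le_def, mk_ord_toType]; exact hI
  -- Coordinate `e i` of `x` records whether `x ∈ S i`. The filter `U` below is generated by the
  -- tails of `H`.
  obtain ⟨H, hH, h⟩ := hκ.exists_eventuallyConst
    fun x i => Function.extend e (fun k => decide (x ∈ S k)) (fun _ => false) i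
  obtain ⟨d₀⟩ : Nonempty κ.ord.ToType := nonempty_ord_toType (aleph0_pos.trans hκ.1).ne'
  let U : Filter κ.ord.ToType :=
    { sets := {T | ∃ d, ∀ x ∈ H, d ≤ x → x ∈ T}
      univ_sets := ⟨d₀, fun _ _ _ => trivial⟩
      sets_of_superset := fun ⟨d, hd⟩ hTT => ⟨d, fun x hx hdx => hTT (hd x hx hdx)⟩
      inter_sets := fun ⟨d, hd⟩ ⟨d', hd'⟩ => ⟨max d d', fun x hx hdx =>
        ⟨hd x hx ((le_max_left _ _).trans hdx), hd' x hx ((le_max_right _ _).trans hdx)⟩⟩ }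
  have hU : ∀ p : κ.ord.ToType → Prop, (∀ᶠ x in U, p x) ↔ ∃ d, ∀ x ∈ H, d ≤ x → p x :=
    fun p => Iff.rfl
  refine ⟨U, ?_, ?_, ?_, ?_⟩
  · refine ⟨fun hbot => ?_⟩
    have : ∀ᶠ x in U, False := by rw [hbot]; exact Filter.mem_bot
    obtain ⟨d, hd⟩ := (hU _).1 this
    obtain ⟨x, hx, hdx⟩ := exists_gt_of_mk_eq hH d
    exact hd x hx hdx
  · intro ι p hι hp
    simp only [hU] at hp ⊢
    choose b hb using hp
    obtain ⟨d, hd⟩ := exists_bound hr hι b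
    exact ⟨d, fun x hx hdx i => hb i x hx ((hd i).le.trans hdx)⟩
  · intro d
    obtain ⟨e, he⟩ := exists_gt hr d
    exact (hU _).2 ⟨e, fun x _ hx => he.trans_le hx⟩
  · intro i
    obtain ⟨c, b, hb⟩ := h (e i)
    simp only [e.injective.extend_apply] at hb
    cases c with
    | true => exact Or.inl ((hU _).2 ⟨b, fun x hx hbx => of_decide_eq_true (hb x hx hbx)⟩)
    | false => exact Or.inr ((hU _).2 ⟨b, fun x hx hbx => of_decide_eq_false (hb x hx hbx)⟩)

/-! ### Filters on which many regressive functions are constant -/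

open ZFSet in
theorem card_vonNeumann_lt {κ : Cardinal.{u}} (hκ : κ.IsInaccessible) {o : Ordinal.{u}}
    (ho : o < κ.ord) : card (V_ o) < κ := by
  rw [card_vonNeumann]
  exact (preBeth_strictMono ho).trans_eq hκ.preBeth_ord

open ZFSet in
theorem card_vonNeumann_ord {κ : Cardinal.{u}} (hκ : κ.IsInaccessible) :
    card (V_ κ.ord) = κ := by
  rw [card_vonNeumann, hκ.preBeth_ord]

theorem mk_shrink_mem (x : ZFSet.{u}) : #(Shrink.{u} {y // y ∈ x}) = ZFSet.card x := by
  have h : #{y // y ∈ x} = lift.{u + 1, u} (ZFSet.card x) := x.cardinalMk_coe_sort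
  rw [← lift_inj.{u, u + 1}, ← h]
  exact (lift_mk_shrink.{u + 1, u, 0} {y // y ∈ x}).trans (lift_id'.{u, u + 1} _)

open ZFSet in
-- This replaces passing from a measure to a normal one. Let `r i` be the rank of `f i`. Among the
-- compositions of the `r i` that are unbounded modulo a suitable `κ`-complete `U`, choose a minimal
-- `h l` and push `U` forward along it. Then `r i ∘ h l` is smaller, hence constant, so `f i ∘ h l`
-- takes values in a set of size less than `κ` and is constant too.
theorem IsWeaklyCompact.exists_regressive_filter {κ : Cardinal.{u}} (hκ : IsWeaklyCompact κ)
    {I : Type u} (hI : #I ≤ κ) (d₀ : κ.ord.ToType) (f : I → κ.ord.ToType → ZFSet.{u})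
    (hf : ∀ i x, d₀ < x → f i x ∈ V_ (x.toOrd : Ordinal.{u})) :
    ∃ W : Filter κ.ord.ToType, W.NeBot ∧ (∀ d, ∀ᶠ x in W, d < x) ∧
      ∀ i, ∃ c ∈ V_ κ.ord, ∀ᶠ x in W, f i x = c := by
  classical
  have hin := hκ.isInaccessible
  have hle := hκ.1.le
  let D := κ.ord.ToType
  -- The default `x` is never used above `d₀`, where the rank is below `x`.
  let r : I → D → D := fun i x =>
    if h : rank (f i x) < κ.ord then Ordinal.ToType.mk ⟨rank (f i x), h⟩ else x
  have hrank : ∀ i x, d₀ < x → rank (f i x) < (x.toOrd : Ordinal.{u}) := fun i x hx =>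
    mem_vonNeumann.1 (hf i x hx)
  have hr : ∀ i x, d₀ < x → ((r i x).toOrd : Ordinal.{u}) = rank (f i x) := by
    intro i x hx
    have h : rank (f i x) < κ.ord := (hrank i x hx).trans x.toOrd.2
    simp [r, h]
  have hrlt : ∀ i x, d₀ < x → r i x < x := by
    intro i x hx
    rw [← Ordinal.ToType.mk.symm.lt_iff_lt, ← Subtype.coe_lt_coe]
    exact (hr i x hx).trans_lt (hrank i x hx)
  let h : List I → D → D := fun l => l.foldr (fun i g => r i ∘ g) id
  let S : (List I × List I) ⊕ (List I × D) ⊕ (I × List I × Shrink.{u} {y // y ∈ V_ κ.ord}) →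
      Set D
    | .inl p => {x | h p.1 x < h p.2 x}
    | .inr (.inl p) => {x | h p.1 x = p.2}
    | .inr (.inr p) => {x | f p.1 (h p.2.1 x) = ((equivShrink _).symm p.2.2).1}
  have hL : #(List I) ≤ κ := (mk_list_le_max I).trans (max_le hle hI)
  have hJ : #((List I × List I) ⊕ (List I × D) ⊕
      (I × List I × Shrink.{u} {y // y ∈ V_ κ.ord})) ≤ κ := by
    have hD : #D ≤ κ := (mk_ord_toType κ).le
    have hV : #(Shrink.{u} {y // y ∈ V_ κ.ord}) ≤ κ := by
      rw [mk_shrink_mem, card_vonNeumann_ord hin]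
    simp only [mk_sum, mk_prod, lift_id]
    refine add_le_of_le hle ?_ (add_le_of_le hle ?_ ?_)
    · exact mul_le_of_le hle hL hL
    · exact mul_le_of_le hle hL hD
    · exact mul_le_of_le hle hI (mul_le_of_le hle hL hV)
  obtain ⟨U, hne, hcomp, htail, hdec⟩ := hκ.exists_filter hJ S
  have hconst : ∀ l, (∃ d, ∀ᶠ x in U, h l x = d) ∨ ∀ d, ∀ᶠ x in U, d < h l x := by
    intro l
    by_contra hcon
    rw [not_or, not_forall] at hcon
    obtain ⟨h1, d, hd⟩ := hcon
    rw [not_exists] at h1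
    refine hd ?_
    obtain ⟨d', hd'⟩ := exists_gt hκ.isRegular d
    have := hcomp (fun (e : Set.Iio d') x => h l x ≠ e) (mk_Iio_toType_lt d') fun e =>
      (hdec (.inr (.inl (l, e)))).resolve_left fun hh => h1 e hh
    filter_upwards [this] with x hx
    by_contra hxd
    exact hx ⟨h l x, (not_lt.1 hxd).trans_lt hd'⟩ rfl
  -- Countable completeness turns a sequence descending modulo `U` into one descending at a single
  -- point `x`.
  have hwf : WellFounded fun l l' => ∀ᶠ x in U, h l x < h l' x := by
    rw [wellFounded_iff_isEmpty_descending_chain]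
    refine ⟨fun ⟨g, hg⟩ => ?_⟩
    have := hcomp (fun (n : ULift.{u} ℕ) x => h (g (n.down + 1)) x < h (g n.down) x)
      (by simpa using hκ.1) fun n => hg n.down
    obtain ⟨x, hx⟩ := this.exists
    exact (wellFounded_iff_isEmpty_descending_chain.1
      (wellFounded_lt (α := D))).false ⟨fun n => h (g n) x, fun n => hx ⟨n⟩⟩
  obtain ⟨l, hl, hmin⟩ := hwf.has_min {l | ∀ d, ∀ᶠ x in U, d < h l x} ⟨[], htail⟩
  refine ⟨U.map (h l), inferInstance, hl, fun i => ?_⟩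
  have hlt : ∀ᶠ x in U, h (i :: l) x < h l x := by
    filter_upwards [hl d₀] with x hx using hrlt i _ hx
  obtain ⟨d, hd⟩ := (hconst (i :: l)).resolve_right fun hh => hmin _ hh hlt
  have hd1 : Order.succ (d.toOrd : Ordinal.{u}) < κ.ord :=
    (isSuccLimit_ord hle).succ_lt d.toOrd.2
  by_contra hcon
  have := hcomp (ι := Shrink.{u} {y // y ∈ V_ (Order.succ (d.toOrd : Ordinal.{u}))})
    (fun v x => f i (h l x) ≠ ((equivShrink _).symm v).1)
    (by rw [mk_shrink_mem]; exact card_vonNeumann_lt hin hd1) fun v => by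
      have hv := vonNeumann_subset_of_le hd1.le ((equivShrink _).symm v).2
      have hv' := fun hh => hcon ⟨_, hv, hh⟩
      have hS : S (.inr (.inr (i, l, equivShrink _ ⟨_, hv⟩))) =
          {x | f i (h l x) = ((equivShrink _).symm v).1} := by simp [S]
      have hd' := hdec (.inr (.inr (i, l, equivShrink _ ⟨_, hv⟩)))
      rw [hS] at hd'
      exact hd'.resolve_left fun hh => hv' (Filter.mem_map.2 hh)
  obtain ⟨x, hx, hxd, hx₀⟩ := (this.and (hd.and (hl d₀))).exists
  have hmem : f i (h l x) ∈ V_ (Order.succ (d.toOrd : Ordinal.{u})) := by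
    rw [mem_vonNeumann, Order.lt_succ_iff, ← hr i _ hx₀, ← hxd]
    rfl
  exact hx (equivShrink _ ⟨_, hmem⟩) (by simp)

/-! ### Elementarity along a filter with constant Skolem functions -/

open ZFSet in
/-- Satisfaction of a first-order formula in `V_o` with unary predicates `A` and `X`. -/
def Sat (o : Ordinal.{u}) (A : Set ZFSet.{u}) {n : ℕ} (X : Fin n → Set ZFSet.{u}) {k : ℕ}
    (φ : (setLang n).BoundedFormula Unit k) (a : {x : ZFSet.{u} // x ∈ V_ o})
    (v : Fin k → {x : ZFSet.{u} // x ∈ V_ o}) : Prop :=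
  @FirstOrder.Language.BoundedFormula.Realize (setLang n) {x : ZFSet.{u} // x ∈ V_ o}
    (setStructure (M := {x : ZFSet.{u} // x ∈ V_ o}) (fun x y => (x : ZFSet.{u}) ∈ (y : ZFSet.{u}))
      {x | (x : ZFSet.{u}) ∈ A} fun i => {x | (x : ZFSet.{u}) ∈ X i}) Unit k φ (fun _ => a) v

/-- The value of a term of `setLang n`. -/
def termVal {M : Type*} {n k : ℕ} (a : M) (v : Fin k → M) :
    (setLang n).Term (Unit ⊕ Fin k) → M
  | .var (.inl _) => a
  | .var (.inr j) => v j
  | .func f _ => Empty.elim f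

theorem realize_eq_termVal {M : Type*} {n k : ℕ} (E : M → M → Prop) (A : Set M)
    (X : Fin n → Set M) (a : M) (v : Fin k → M) (t : (setLang n).Term (Unit ⊕ Fin k)) :
    @FirstOrder.Language.Term.realize (setLang n) M (setStructure E A X) _
      (Sum.elim (fun _ => a) v) t = termVal a v t := by
  rcases t with (_ | j) | ⟨f, _⟩
  · rfl
  · rfl
  · exact Empty.elim f

theorem map_termVal {M N : Type*} {n k : ℕ} (g : M → N) (a : M) (v : Fin k → M)
    (t : (setLang n).Term (Unit ⊕ Fin k)) :
    g (termVal a v t) = termVal (g a) (fun j => g (v j)) t := by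
  rcases t with (_ | j) | ⟨f, _⟩
  · rfl
  · rfl
  · exact Empty.elim f

section Sat

variable {o : Ordinal.{u}} {A : Set ZFSet.{u}} {n k : ℕ} {X : Fin n → Set ZFSet.{u}}
  {a : {x : ZFSet.{u} // x ∈ ZFSet.vonNeumann o}}
  {v : Fin k → {x : ZFSet.{u} // x ∈ ZFSet.vonNeumann o}}

theorem sat_equal (t₁ t₂ : (setLang n).Term (Unit ⊕ Fin k)) :
    Sat o A X (.equal t₁ t₂) a v ↔
      termVal (a : ZFSet) (fun j => (v j : ZFSet)) t₁ =
        termVal (a : ZFSet) (fun j => (v j : ZFSet)) t₂ := by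
  unfold Sat
  simp only [FirstOrder.Language.BoundedFormula.Realize]
  rw [realize_eq_termVal, realize_eq_termVal, Subtype.ext_iff, map_termVal Subtype.val,
    map_termVal Subtype.val]

theorem sat_rel {l : ℕ} (R : SetRel n l) (t : Fin l → (setLang n).Term (Unit ⊕ Fin k)) :
    Sat o A X (.rel (L := setLang n) R t) a v ↔
      @FirstOrder.Language.Structure.RelMap (setLang n) ZFSet (setStructure (· ∈ ·) A X) l R
        fun i => termVal (a : ZFSet) (fun j => (v j : ZFSet)) (t i) := by
  unfold Sat
  simp only [FirstOrder.Language.BoundedFormula.Realize]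
  cases R <;>
  · simp only [realize_eq_termVal, ← map_termVal Subtype.val]
    rfl

theorem sat_imp (φ ψ : (setLang n).BoundedFormula Unit k) :
    Sat o A X (φ.imp ψ) a v ↔ (Sat o A X φ a v → Sat o A X ψ a v) := Iff.rfl

theorem sat_all (φ : (setLang n).BoundedFormula Unit (k + 1)) :
    Sat o A X φ.all a v ↔ ∀ y, Sat o A X φ a (Fin.snoc v y) := Iff.rfl

end Sat

open ZFSet in
open Classical in
/-- A counterexample to `∀ y, φ` in `V_o`, if there is one. -/
noncomputable def skolem (o : Ordinal.{u}) (A : Set ZFSet.{u}) {n : ℕ} (X : Fin n → Set ZFSet.{u})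
    (a : ZFSet.{u}) {k : ℕ} (φ : (setLang n).BoundedFormula Unit (k + 1))
    (v : Fin k → ZFSet.{u}) : ZFSet.{u} :=
  if h : ∃ y : {x : ZFSet.{u} // x ∈ V_ o}, ∃ (ha : a ∈ V_ o) (hv : ∀ j, v j ∈ V_ o),
    ¬ Sat o A X φ ⟨a, ha⟩ (Fin.snoc (fun j => ⟨v j, hv j⟩) y) then h.choose else ∅

open ZFSet in
theorem skolem_mem {o : Ordinal.{u}} (ho : 0 < o) (A : Set ZFSet.{u}) {n : ℕ}
    (X : Fin n → Set ZFSet.{u}) (a : ZFSet.{u}) {k : ℕ}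
    (φ : (setLang n).BoundedFormula Unit (k + 1)) (v : Fin k → ZFSet.{u}) :
    skolem o A X a φ v ∈ V_ o := by
  unfold skolem
  split_ifs with h
  · exact h.choose.2
  · simpa [mem_vonNeumann] using ho

open ZFSet in
theorem not_sat_skolem {o : Ordinal.{u}} {A : Set ZFSet.{u}} {n : ℕ}
    {X : Fin n → Set ZFSet.{u}} {a : ZFSet.{u}} {k : ℕ}
    {φ : (setLang n).BoundedFormula Unit (k + 1)} {v : Fin k → ZFSet.{u}} (ha : a ∈ V_ o)
    (hv : ∀ j, v j ∈ V_ o) (h : ¬ Sat o A X φ.all ⟨a, ha⟩ fun j => ⟨v j, hv j⟩) :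
    ∃ hs : skolem o A X a φ v ∈ V_ o,
      ¬ Sat o A X φ ⟨a, ha⟩ (Fin.snoc (fun j => ⟨v j, hv j⟩) ⟨skolem o A X a φ v, hs⟩) := by
  rw [sat_all, not_forall] at h
  obtain ⟨y, hy⟩ := h
  have h : ∃ y : {x : ZFSet.{u} // x ∈ V_ o}, ∃ (ha : a ∈ V_ o) (hv : ∀ j, v j ∈ V_ o),
      ¬ Sat o A X φ ⟨a, ha⟩ (Fin.snoc (fun j => ⟨v j, hv j⟩) y) := ⟨y, ha, hv, hy⟩
  have he : skolem o A X a φ v = h.choose := dif_pos h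
  obtain ⟨_, _, h3⟩ := h.choose_spec
  refine ⟨he ▸ h.choose.2, ?_⟩
  simpa only [he] using h3

open ZFSet in
-- A Łoś theorem by induction on formulas, comparing `V_x` carrying the predicates `X x` with `V_κ`
-- carrying their limits along `W`. In the quantifier case the least information needed is a fixed
-- counterexample. If the universal statement holds in `V_κ`, the Skolem value in `V_x` is
-- eventually a fixed `c`, and the induction hypothesis at `c` applies. If it fails, a
-- counterexample in `V_κ` eventually lies in `V_x`. Only finite intersections in `W` are used.
theorem eventually_sat_iff {κ : Cardinal.{u}} {W : Filter κ.ord.ToType}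
    (htail : ∀ d, ∀ᶠ x in W, d < x) (A : Set ZFSet.{u}) {n : ℕ}
    (X : κ.ord.ToType → Fin n → Set ZFSet.{u}) (a : {x : ZFSet.{u} // x ∈ V_ κ.ord})
    (hX : ∀ i, ∀ z ∈ V_ κ.ord, (∀ᶠ x in W, z ∈ X x i) ∨ ∀ᶠ x in W, z ∉ X x i)
    (hsk : ∀ (k : ℕ) (φ : (setLang n).BoundedFormula Unit (k + 1))
      (v : Fin k → {x : ZFSet.{u} // x ∈ V_ κ.ord}), ∃ c ∈ V_ κ.ord,
      ∀ᶠ x in W, skolem (x.toOrd : Ordinal.{u}) A (X x) a φ (fun j => (v j : ZFSet)) = c)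
    {k : ℕ} (φ : (setLang n).BoundedFormula Unit k)
    (v : Fin k → {x : ZFSet.{u} // x ∈ V_ κ.ord}) :
    ∀ᶠ x in W, ∀ (ha : (a : ZFSet) ∈ V_ (x.toOrd : Ordinal.{u}))
      (hv : ∀ j, (v j : ZFSet) ∈ V_ (x.toOrd : Ordinal.{u})),
      (Sat (x.toOrd : Ordinal.{u}) A (X x) φ ⟨a, ha⟩ (fun j => ⟨v j, hv j⟩) ↔
        Sat κ.ord A (fun i => {z | ∀ᶠ x in W, z ∈ X x i}) φ a v) := by
  have hmem : ∀ z ∈ V_ κ.ord, ∀ᶠ x in W, z ∈ V_ (x.toOrd : Ordinal.{u}) := fun z hz => by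
    filter_upwards [htail (Ordinal.ToType.mk ⟨rank z, mem_vonNeumann.1 hz⟩)] with x hx
    rw [← Ordinal.ToType.mk.symm.lt_iff_lt, ← Subtype.coe_lt_coe] at hx
    simpa [mem_vonNeumann] using hx
  induction φ with
  | falsum => exact .of_forall fun x ha hv => Iff.rfl
  | equal t₁ t₂ =>
    refine .of_forall fun x ha hv => ?_
    rw [sat_equal, sat_equal]
  | rel R t =>
    cases R with
    | mem =>
      exact .of_forall fun x ha hv => (sat_rel SetRel.mem t).trans
        (Iff.trans (by exact Iff.rfl) (sat_rel SetRel.mem t).symm)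
    | param =>
      exact .of_forall fun x ha hv => (sat_rel SetRel.param t).trans
        (Iff.trans (by exact Iff.rfl) (sat_rel SetRel.param t).symm)
    | var i =>
      have hz : termVal (a : ZFSet) (fun j => (v j : ZFSet)) (t 0) ∈ V_ κ.ord := by
        rw [← map_termVal Subtype.val]; exact Subtype.coe_prop _
      have key : ∀ᶠ x in W, (termVal (a : ZFSet) (fun j => (v j : ZFSet)) (t 0) ∈ X x i ↔
          ∀ᶠ x in W, termVal (a : ZFSet) (fun j => (v j : ZFSet)) (t 0) ∈ X x i) := by
        by_cases hb : ∀ᶠ x in W, termVal (a : ZFSet) (fun j => (v j : ZFSet)) (t 0) ∈ X x i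
        · filter_upwards [hb] with x hx using iff_of_true hx hb
        · filter_upwards [(hX i _ hz).resolve_left hb] with x hx using iff_of_false hx hb
      filter_upwards [key] with x hx ha hv
      refine (sat_rel (SetRel.var i) t).trans ?_
      refine Iff.trans ?_ (sat_rel (SetRel.var i) t).symm
      exact hx
  | imp φ ψ ih₁ ih₂ =>
    filter_upwards [ih₁ v, ih₂ v] with x h₁ h₂ ha hv
    rw [sat_imp, sat_imp, h₁ ha hv, h₂ ha hv]
  | @all k φ ih =>
    by_cases hall : Sat κ.ord A (fun i => {z | ∀ᶠ x in W, z ∈ X x i}) φ.all a v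
    · obtain ⟨c, hc, hcW⟩ := hsk k φ v
      filter_upwards [hcW, ih (Fin.snoc v ⟨c, hc⟩), hmem c hc] with x hx h hcx ha hv
      refine iff_of_true ?_ hall
      by_contra hcon
      obtain ⟨hs, hns⟩ := not_sat_skolem ha hv hcon
      subst hx
      have hv' : ∀ j, ((Fin.snoc v ⟨_, hc⟩ : Fin (k + 1) → {x : ZFSet.{u} // x ∈ V_ κ.ord}) j :
          ZFSet) ∈ V_ (x.toOrd : Ordinal.{u}) := by
        intro j
        refine Fin.lastCases ?_ (fun j => ?_) j
        · simpa using hcx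
        · simpa using hv j
      refine hns ?_
      convert (h ha hv').2 (hall _) using 2 with j
      refine Fin.lastCases ?_ (fun j => ?_) j <;> simp
    · rw [sat_all, not_forall] at hall
      obtain ⟨c, hc⟩ := hall
      filter_upwards [ih (Fin.snoc v c), hmem c c.2] with x h hcx ha hv
      refine iff_of_false (fun hcon => hc ?_) fun hcon => hc (hcon c)
      have hv' : ∀ j, ((Fin.snoc v c : Fin (k + 1) → {x : ZFSet.{u} // x ∈ V_ κ.ord}) j :
          ZFSet) ∈ V_ (x.toOrd : Ordinal.{u}) := by
        intro j
        refine Fin.lastCases ?_ (fun j => ?_) j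
        · simpa using hcx
        · simpa using hv j
      refine (h ha hv').1 ?_
      convert (sat_all φ).1 hcon ⟨c.1, hcx⟩ using 2 with j
      refine Fin.lastCases ?_ (fun j => ?_) j <;> simp

/-! ### The weakly compact filter is proper -/

theorem mk_initialSeg_lt {κ : Cardinal.{u}} {α : Ordinal.{u}} (hα : α < κ.ord) :
    #(initialSeg κ α) < κ := by
  refine mk_lt_of_bounded (d := Ordinal.ToType.mk ⟨α, hα⟩) fun x hx => ?_
  rw [← Ordinal.ToType.mk.symm.lt_iff_lt, ← Subtype.coe_lt_coe]
  simpa [initialSeg] using hx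

theorem countable_sigma_boundedFormula (n : ℕ) :
    Countable (Σ k, (setLang n).BoundedFormula Unit k) := by
  have hc : ∀ l, Countable (SetRel n l) := fun l => by
    refine Function.Injective.countable (f := fun r : SetRel n l => match r with
      | .mem => 0 | .param => 1 | .var i => (i : ℕ) + 2) ?_
    intro r r' h
    cases r <;> cases r' <;> simp_all [Fin.ext_iff]
  have h1 : Countable (setLang n).Symbols := by
    have : ∀ l, Countable ((setLang n).Functions l) := fun l =>
      inferInstanceAs (Countable Empty)
    have : ∀ l, Countable ((setLang n).Relations l) := hc
    unfold FirstOrder.Language.Symbols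
    infer_instance
  rw [← mk_le_aleph0_iff]
  refine (FirstOrder.Language.BoundedFormula.card_le (L := setLang n) (α := Unit)).trans ?_
  have h2 : (setLang n).card ≤ ℵ₀ := mk_le_aleph0_iff.2 h1
  simpa [add_le_aleph0] using h2

theorem mk_sigma_le_of_le {κ : Cardinal.{u}} (h0 : ℵ₀ ≤ κ) {ι : Type u} {β : ι → Type u}
    (hι : #ι ≤ κ) (hβ : ∀ i, #(β i) ≤ κ) : #(Σ i, β i) ≤ κ := by
  rw [mk_sigma]
  refine (sum_le_sum _ (fun _ => κ) hβ).trans ?_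
  simpa using mul_le_of_le h0 hι le_rfl

theorem mk_sigma_le_of_countable {κ : Cardinal.{u}} (h0 : ℵ₀ ≤ κ) {ι : Type} [Countable ι]
    {β : ι → Type u} (hβ : ∀ i, #(β i) ≤ κ) : #(Σ i, β i) ≤ κ := by
  rw [mk_sigma]
  refine (sum_le_sum _ (fun _ => κ) hβ).trans ?_
  rw [sum_const, lift_uzero]
  exact mul_le_of_le h0 ((lift_le_aleph0.2 mk_le_aleph0).trans h0) le_rfl

open ZFSet in
open Classical in
/-- Set variables witnessing that a `Π¹₁`-formula fails in `V_o`. -/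
noncomputable def counterex (o : Ordinal.{u}) (Φ : Pi11Formula) (A : Set ZFSet.{u})
    (a : ZFSet.{u}) : Fin Φ.numVars → Set ZFSet.{u} :=
  if h : ∃ X : Fin Φ.numVars → Set ZFSet.{u}, ∃ ha : a ∈ V_ o,
    ¬ Sat o A X Φ.matrix ⟨a, ha⟩ default then h.choose else fun _ => ∅

open ZFSet in
-- Only the trace of a set variable on `V_o` matters, so the variables may range over arbitrary sets
-- of `ZFSet`. The same `X` can then be read at different levels.
theorem vsat_iff {o : Ordinal.{u}} {Φ : Pi11Formula} {A : Set ZFSet.{u}} {a : ZFSet.{u}} :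
    VSat o Φ A a ↔ ∃ ha : a ∈ V_ o, ∀ X : Fin Φ.numVars → Set ZFSet.{u},
      Sat o A X Φ.matrix ⟨a, ha⟩ default := by
  refine exists_congr fun ha => ⟨fun h X => h fun i => {x | (x : ZFSet.{u}) ∈ X i}, fun h X => ?_⟩
  have := h fun i => Subtype.val '' X i
  unfold Sat at this
  have e : (fun i => {x : {x : ZFSet.{u} // x ∈ V_ o} | (x : ZFSet.{u}) ∈ Subtype.val '' X i}) =
      X := by
    funext i
    ext x
    simp
  rw [e] at this
  exact this

open ZFSet in
theorem not_sat_counterex {o : Ordinal.{u}} {Φ : Pi11Formula} {A : Set ZFSet.{u}}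
    {a : ZFSet.{u}} (ha : a ∈ V_ o) (h : ¬ VSat o Φ A a) :
    ¬ Sat o A (counterex o Φ A a) Φ.matrix ⟨a, ha⟩ default := by
  rw [vsat_iff] at h
  push Not at h
  have h' : ∃ X : Fin Φ.numVars → Set ZFSet.{u}, ∃ ha : a ∈ V_ o,
    ¬ Sat o A X Φ.matrix ⟨a, ha⟩ default := (h ha).imp fun X hX => ⟨ha, hX⟩
  have he : counterex o Φ A a = h'.choose := dif_pos h'
  rw [he]
  exact h'.choose_spec.2

open ZFSet in
open Classical in
/-- The truth value of a proposition as an element of `V_2`. -/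
noncomputable def truthVal (p : Prop) : ZFSet.{u} := if p then {∅} else ∅

open ZFSet in
theorem truthVal_mem {o : Ordinal.{u}} (ho : 1 < o) (p : Prop) : truthVal p ∈ V_ o := by
  unfold truthVal
  split_ifs
  · simpa [mem_vonNeumann] using ho
  · simpa [mem_vonNeumann] using zero_lt_one.trans ho

theorem eventually_or_of_truthVal {D : Type*} {W : Filter D} {p : D → Prop} {c : ZFSet.{u}}
    (h : ∀ᶠ x in W, truthVal (p x) = c) : (∀ᶠ x in W, p x) ∨ ∀ᶠ x in W, ¬ p x := by
  have hne : ({∅} : ZFSet.{u}) ≠ ∅ := fun h => by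
    have : (∅ : ZFSet.{u}) ∈ ({∅} : ZFSet.{u}) := by simp
    rw [h] at this
    exact ZFSet.notMem_empty _ this
  by_cases hc : c = ∅
  · right
    filter_upwards [h] with x hx hp
    rw [hc, truthVal, if_pos hp] at hx
    exact hne hx
  · left
    filter_upwards [h] with x hx
    by_contra hp
    rw [truthVal, if_neg hp] at hx
    exact hc hx.symm

open ZFSet in
-- For finitely many generators, one filter `W` decides whether each formula holds at `x`. Were one
-- to fail almost everywhere, its counterexamples would have a limit on `V_κ`, where the matrix
-- holds. Elementarity would then make it hold at some `V_x` with the counterexample itself.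
theorem IsWeaklyCompact.wcFilter_neBot {κ : Cardinal.{u}} (hκ : IsWeaklyCompact κ) :
    (wcFilter κ).NeBot := by
  classical
  have hin := hκ.isInaccessible
  have hle := hκ.1.le
  rw [wcFilter, Filter.generate_neBot_iff]
  intro t ht htf
  have ht' : ∀ R : t, ∃ (Φ : Pi11Formula) (A : Set ZFSet.{u}) (a : ZFSet.{u}),
    a ∈ V_ κ.ord ∧ VSat κ.ord Φ A a ∧ R.1 = reflectionSet κ Φ A a := fun R => by
      obtain ⟨Φ, A, a, -, h⟩ := ht R.2
      exact ⟨Φ, A, a, h⟩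
  choose Φ A a ha hV hR using ht'
  let K := Shrink.{u} {y // y ∈ V_ κ.ord}
  -- Three kinds of functions are to be made constant: the truth of the formula at `x`, membership
  -- of each `z ∈ V_κ` in each counterexample set, and the Skolem functions.
  let I := Σ R : t, PUnit.{u + 1} ⊕ (Fin (Φ R).numVars × K) ⊕
    Σ p : (Σ k, (setLang (Φ R).numVars).BoundedFormula Unit k), Fin p.1 → K
  have hK : #K ≤ κ := by rw [mk_shrink_mem, card_vonNeumann_ord hin]
  have hI : #I ≤ κ := by
    refine mk_sigma_le_of_le hle ?_ fun R => ?_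
    · exact (htf.lt_aleph0.trans hκ.1).le
    · have := countable_sigma_boundedFormula (Φ R).numVars
      simp only [mk_sum, lift_id]
      refine add_le_of_le hle ?_ (add_le_of_le hle ?_ ?_)
      · simpa using one_le_aleph0.trans hle
      · rw [mk_prod, lift_uzero]
        refine mul_le_of_le hle ?_ hK
        simpa using (natCast_lt_aleph0.trans hκ.1).le
      · refine mk_sigma_le_of_countable hle fun p => ?_
        rw [mk_arrow, mk_fin, lift_natCast, lift_id', power_natCast]
        exact (pow_le_pow_left' hK _).trans (power_nat_le hle)
  have h1 : (1 : Ordinal.{u}) < κ.ord := by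
    rw [lt_ord, Ordinal.card_one]
    exact one_lt_aleph0.trans hκ.1
  -- Truth values lie in `V_2`, so they are regressive above `1`.
  let d₀ : κ.ord.ToType := Ordinal.ToType.mk ⟨1, h1⟩
  have hd₀ : ∀ x, d₀ < x → (1 : Ordinal.{u}) < x.toOrd := fun x hx => by
    rw [← Ordinal.ToType.mk.symm.lt_iff_lt, ← Subtype.coe_lt_coe] at hx
    simpa [d₀] using hx
  let X : ∀ R : t, κ.ord.ToType → Fin (Φ R).numVars → Set ZFSet.{u} := fun R x =>
    counterex (x.toOrd : Ordinal.{u}) (Φ R) (A R) (a R)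
  let out : ∀ {k : ℕ}, (Fin k → K) → Fin k → ZFSet.{u} := fun v j => ((equivShrink _).symm (v j)).1
  let f : I → κ.ord.ToType → ZFSet.{u} := fun ⟨R, s⟩ x => match s with
    | .inl _ => truthVal (VSat (x.toOrd : Ordinal.{u}) (Φ R) (A R) (a R))
    | .inr (.inl (i, z)) => truthVal (((equivShrink _).symm z).1 ∈ X R x i)
    | .inr (.inr ⟨⟨0, _⟩, _⟩) => ∅
    -- The last entry of `v` is a dummy: the quantified variable of `φ` is not a parameter of its
    -- Skolem function.
    | .inr (.inr ⟨⟨k + 1, φ⟩, v⟩) =>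
      skolem (x.toOrd : Ordinal.{u}) (A R) (X R x) (a R) φ fun j : Fin k => out v j.castSucc
  obtain ⟨W, hW, htail, hconst⟩ := hκ.exists_regressive_filter hI d₀ f (by
    rintro ⟨R, s | ⟨i, z⟩ | ⟨⟨k | k, φ⟩, v⟩⟩ x hx
    · exact truthVal_mem (hd₀ x hx) _
    · exact truthVal_mem (hd₀ x hx) _
    · simpa [f, mem_vonNeumann] using zero_lt_one.trans (hd₀ x hx)
    · exact skolem_mem (zero_lt_one.trans (hd₀ x hx)) _ _ _ _ _)
  have key : ∀ R : t, ∀ᶠ x in W, VSat (x.toOrd : Ordinal.{u}) (Φ R) (A R) (a R) := by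
    intro R
    obtain ⟨c, -, hc⟩ := hconst ⟨R, .inl ⟨⟩⟩
    refine (eventually_or_of_truthVal hc).resolve_right fun hns => ?_
    have hsat := eventually_sat_iff htail (A R) (X R) ⟨a R, ha R⟩ (fun i z hz => by
        obtain ⟨c, -, hc⟩ := hconst ⟨R, .inr (.inl (i, equivShrink _ ⟨z, hz⟩))⟩
        simpa [f] using eventually_or_of_truthVal hc) (fun k φ v => by
        by_cases hk : Nonempty K
        · obtain ⟨k₀⟩ := hk
          have := hconst ⟨R, .inr (.inr ⟨⟨k + 1, φ⟩,
            Fin.snoc (fun j => equivShrink _ (v j)) k₀⟩)⟩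
          simpa [f, out] using this
        · exact absurd ⟨equivShrink _ ⟨a R, ha R⟩⟩ hk) (Φ R).matrix default
    have htrue : Sat κ.ord (A R) (fun i => {z | ∀ᶠ x in W, z ∈ X R x i}) (Φ R).matrix
        ⟨a R, ha R⟩ default := (vsat_iff.1 (hV R)).2 _
    obtain ⟨x, hx, hxs, hxa⟩ := (hns.and (hsat.and
      (htail (Ordinal.ToType.mk ⟨rank (a R), mem_vonNeumann.1 (ha R)⟩)))).exists
    have hmem : a R ∈ V_ (x.toOrd : Ordinal.{u}) := by
      rw [← Ordinal.ToType.mk.symm.lt_iff_lt, ← Subtype.coe_lt_coe] at hxa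
      simpa [mem_vonNeumann] using hxa
    refine not_sat_counterex hmem hx ?_
    convert (hxs hmem fun j => j.elim0).2 htrue
  have : Finite t := htf
  obtain ⟨x, hx⟩ := (Filter.eventually_all.2 key).exists
  refine ⟨⟨initialSeg κ (x.toOrd : Ordinal.{u}), mk_initialSeg_lt x.toOrd.2⟩, fun R hRt => ?_⟩
  change _ ∈ (⟨R, hRt⟩ : t).1
  rw [hR ⟨R, hRt⟩]
  exact ⟨_, x.toOrd.2, hx ⟨R, hRt⟩, rfl⟩

/-! ### Two families of sets in the weakly compact filter -/

section Formulas

open FirstOrder.Language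

/-- The atomic formula `xᵢ ∈ xⱼ`. -/
def memF {n k : ℕ} (i j : Fin k) : (setLang n).BoundedFormula Unit k :=
  .rel (L := setLang n) SetRel.mem ![.var (.inr i), .var (.inr j)]

/-- The atomic formula `xᵢ = xⱼ`. -/
def eqF {n k : ℕ} (i j : Fin k) : (setLang n).BoundedFormula Unit k :=
  .equal (.var (.inr i)) (.var (.inr j))

/-- The atomic formula stating that `xᵢ` belongs to the second-order parameter. -/
def paramF {n k : ℕ} (i : Fin k) : (setLang n).BoundedFormula Unit k :=
  .rel (L := setLang n) SetRel.param ![.var (.inr i)]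

/-- The atomic formula stating that `xᵢ` belongs to the set variable `X_m`. -/
def varF {n k : ℕ} (m : Fin n) (i : Fin k) : (setLang n).BoundedFormula Unit k :=
  .rel (L := setLang n) (SetRel.var m) ![.var (.inr i)]

variable {o : Ordinal.{u}} {A : Set ZFSet.{u}} {n k : ℕ} {X : Fin n → Set ZFSet.{u}}
  {a : {x : ZFSet.{u} // x ∈ ZFSet.vonNeumann o}}
  {v : Fin k → {x : ZFSet.{u} // x ∈ ZFSet.vonNeumann o}}

theorem sat_memF (i j : Fin k) : Sat o A X (memF i j) a v ↔ (v i : ZFSet) ∈ (v j : ZFSet) :=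
  sat_rel _ _

theorem sat_eqF (i j : Fin k) : Sat o A X (eqF i j) a v ↔ (v i : ZFSet) = v j :=
  sat_equal _ _

theorem sat_paramF (i : Fin k) : Sat o A X (paramF i) a v ↔ (v i : ZFSet) ∈ A :=
  sat_rel _ _

theorem sat_varF (m : Fin n) (i : Fin k) : Sat o A X (varF m i) a v ↔ (v i : ZFSet) ∈ X m :=
  sat_rel _ _

theorem sat_not (φ : (setLang n).BoundedFormula Unit k) :
    Sat o A X φ.not a v ↔ ¬ Sat o A X φ a v := Iff.rfl

theorem sat_ex (φ : (setLang n).BoundedFormula Unit (k + 1)) :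
    Sat o A X φ.ex a v ↔ ∃ y, Sat o A X φ a (Fin.snoc v y) :=
  letI := setStructure (M := {x : ZFSet.{u} // x ∈ ZFSet.vonNeumann o})
    (fun x y => (x : ZFSet.{u}) ∈ (y : ZFSet.{u}))
    {x | (x : ZFSet.{u}) ∈ A} fun i => {x | (x : ZFSet.{u}) ∈ X i}
  BoundedFormula.realize_ex

theorem sat_inf (φ ψ : (setLang n).BoundedFormula Unit k) :
    Sat o A X (φ ⊓ ψ) a v ↔ Sat o A X φ a v ∧ Sat o A X ψ a v :=
  letI := setStructure (M := {x : ZFSet.{u} // x ∈ ZFSet.vonNeumann o})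
    (fun x y => (x : ZFSet.{u}) ∈ (y : ZFSet.{u}))
    {x | (x : ZFSet.{u}) ∈ A} fun i => {x | (x : ZFSet.{u}) ∈ X i}
  BoundedFormula.realize_inf

theorem sat_sup (φ ψ : (setLang n).BoundedFormula Unit k) :
    Sat o A X (φ ⊔ ψ) a v ↔ Sat o A X φ a v ∨ Sat o A X ψ a v :=
  letI := setStructure (M := {x : ZFSet.{u} // x ∈ ZFSet.vonNeumann o})
    (fun x y => (x : ZFSet.{u}) ∈ (y : ZFSet.{u}))
    {x | (x : ZFSet.{u}) ∈ A} fun i => {x | (x : ZFSet.{u}) ∈ X i}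
  BoundedFormula.realize_sup

theorem sat_iff (φ ψ : (setLang n).BoundedFormula Unit k) :
    Sat o A X (φ.iff ψ) a v ↔ (Sat o A X φ a v ↔ Sat o A X ψ a v) :=
  letI := setStructure (M := {x : ZFSet.{u} // x ∈ ZFSet.vonNeumann o})
    (fun x y => (x : ZFSet.{u}) ∈ (y : ZFSet.{u}))
    {x | (x : ZFSet.{u}) ∈ A} fun i => {x | (x : ZFSet.{u}) ∈ X i}
  BoundedFormula.realize_iff

/-- "Every `x` has a singleton that is an element of an element of the parameter." -/
def singletonFormula : Pi11Formula where
  numVars := 0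
  matrix := BoundedFormula.all <| BoundedFormula.ex <| paramF (1 : Fin 2) ⊓
    BoundedFormula.ex (memF (2 : Fin 3) 1 ⊓
      BoundedFormula.all ((memF (3 : Fin 4) 2).iff (eqF 3 0)))

/-- "The pair `{x₀, x₁}` belongs to the parameter." -/
def pairF : (setLang 1).BoundedFormula Unit 2 :=
  BoundedFormula.ex <| paramF (2 : Fin 3) ⊓
    BoundedFormula.all ((memF (3 : Fin 4) 2).iff (eqF 3 0 ⊔ eqF 3 1))

/-- "Every `X` is contained in a set, or contains two distinct elements whose pair belongs to the
parameter, or there is `y` such that no pair `{y, z}` with `z ∈ X` belongs to the parameter." -/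
def boundedFormula : Pi11Formula where
  numVars := 1
  matrix := BoundedFormula.ex (BoundedFormula.all ((varF 0 (1 : Fin 2)).imp (memF 1 0))) ⊔
    (BoundedFormula.ex (BoundedFormula.ex
      (varF 0 (0 : Fin 2) ⊓ (varF 0 1 ⊓ ((eqF 0 1).not ⊓ pairF)))) ⊔
    BoundedFormula.ex (BoundedFormula.all ((varF 0 (1 : Fin 2)).imp pairF.not)))

end Formulas

/-! ### Meaning of the two formulas and reflection of closure and boundedness -/

open ZFSet

theorem vsat_singletonFormula {o : Ordinal.{u}} {A : Set ZFSet.{u}} {a : ZFSet.{u}} :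
    VSat o singletonFormula A a ↔ a ∈ V_ o ∧ ∀ x ∈ V_ o, ∃ z ∈ V_ o, z ∈ A ∧
      ∃ w ∈ V_ o, w ∈ z ∧ ∀ y ∈ V_ o, (y ∈ w ↔ y = x) := by
  rw [vsat_iff]
  simp only [singletonFormula, sat_all, sat_ex, sat_inf, sat_paramF, sat_memF, sat_iff, sat_eqF,
    Subtype.exists, Subtype.forall]
  simp [Fin.snoc, and_left_comm]

theorem sat_pairF {o : Ordinal.{u}} {A : Set ZFSet.{u}} {X : Fin 1 → Set ZFSet.{u}}
    {a : {x : ZFSet.{u} // x ∈ V_ o}} {v : Fin 2 → {x : ZFSet.{u} // x ∈ V_ o}} :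
    Sat o A X pairF a v ↔ ∃ p ∈ V_ o, p ∈ A ∧ ∀ w ∈ V_ o,
      (w ∈ p ↔ w = (v 0 : ZFSet) ∨ w = (v 1 : ZFSet)) := by
  simp only [pairF, sat_all, sat_ex, sat_inf, sat_sup, sat_paramF, sat_memF, sat_iff, sat_eqF,
    Subtype.exists, Subtype.forall]
  simp [Fin.snoc, and_left_comm]

theorem vsat_boundedFormula {o : Ordinal.{u}} {A : Set ZFSet.{u}} {a : ZFSet.{u}} :
    VSat o boundedFormula A a ↔ a ∈ V_ o ∧ ∀ X : Set ZFSet.{u},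
      (∃ x ∈ V_ o, ∀ y ∈ V_ o, y ∈ X → y ∈ x) ∨
      (∃ y ∈ V_ o, ∃ z ∈ V_ o, y ∈ X ∧ z ∈ X ∧ y ≠ z ∧
        ∃ p ∈ V_ o, p ∈ A ∧ ∀ w ∈ V_ o, (w ∈ p ↔ w = y ∨ w = z)) ∨
      (∃ y ∈ V_ o, ∀ z ∈ V_ o, z ∈ X →
        ¬ ∃ p ∈ V_ o, p ∈ A ∧ ∀ w ∈ V_ o, (w ∈ p ↔ w = y ∨ w = z)) := by
  rw [vsat_iff, ← exists_prop]
  refine exists_congr fun ha => ?_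
  have : ∀ p : (Fin 1 → Set ZFSet.{u}) → Prop, (∀ X, p X) ↔ ∀ X : Set ZFSet.{u}, p fun _ => X :=
    fun p => ⟨fun h X => h _, fun h X => by
      have := h (X 0)
      convert this using 2 with i
      rw [Subsingleton.elim i 0]⟩
  refine (this _).trans (forall_congr' fun X => ?_)
  simp only [boundedFormula, sat_sup, sat_ex, sat_all, sat_imp, sat_inf, sat_not, sat_varF,
    sat_memF, sat_eqF, sat_pairF, Subtype.exists, Subtype.forall]
  simp [Fin.snoc, and_left_comm]

theorem mem_initialSeg {κ : Cardinal.{u}} {α : Ordinal.{u}} {x : κ.ord.ToType} :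
    x ∈ initialSeg κ α ↔ (x.toOrd : Ordinal.{u}) < α := Iff.rfl

theorem initialSeg_injective {κ : Cardinal.{u}} {α β : Ordinal.{u}} (hα : α < κ.ord)
    (hβ : β < κ.ord) (h : initialSeg κ α = initialSeg κ β) : α = β := by
  have key : ∀ γ : Ordinal.{u}, ∀ hγ : γ < κ.ord, (γ < α ↔ γ < β) := fun γ hγ => by
    have := Set.ext_iff.1 h (Ordinal.ToType.mk ⟨γ, hγ⟩)
    simpa [mem_initialSeg] using this
  refine le_antisymm ?_ ?_
  · by_contra! hlt
    exact lt_irrefl _ ((key β hβ).1 hlt)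
  · by_contra! hlt
    exact lt_irrefl _ ((key α hα).2 hlt)

/-- The closure points of a function on the ordinals below `κ` form a set in the weakly compact
filter. -/
theorem closure_mem_wcFilter {κ : Cardinal.{u}} (h0 : ℵ₀ ≤ κ) (G : Ordinal.{u} → Ordinal.{u})
    (hG : ∀ β < κ.ord, G β < κ.ord) :
    {x : Pk κ κ.ord.ToType | ∃ α < κ.ord, 0 < α ∧ (x : Set κ.ord.ToType) = initialSeg κ α ∧
      ∀ β < α, G β < α} ∈ wcFilter κ := by
  have hlim := isSuccLimit_ord h0
  -- `A` is the graph of `z ↦ V_(G (rank z))`. If every point of `V_α` is the first coordinate of a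
  -- pair in `A ∩ V_α`, then `α` is closed under `G`.
  let A : Set ZFSet.{u} := {p | ∃ z ∈ V_ κ.ord, p = pair z (V_ (G (rank z)))}
  have hpair : ∀ z ∈ V_ κ.ord, pair z (V_ (G (rank z))) ∈ V_ κ.ord := fun z hz => by
    rw [mem_vonNeumann] at *
    have := hlim.succ_lt (hG _ hz)
    have := hlim.succ_lt hz
    simp only [pair, rank_pair, rank_singleton, rank_vonNeumann]
    refine max_lt (hlim.succ_lt ‹_›) (hlim.succ_lt (max_lt ‹_› ‹_›))
  have hsub : reflectionSet κ singletonFormula A ∅ ∈ wcFilter κ := by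
    refine Filter.mem_generate_of_mem ⟨singletonFormula, A, ∅, ?_, ?_, ?_, rfl⟩
    · rintro _ ⟨z, hz, rfl⟩
      exact hpair z hz
    · simpa [mem_vonNeumann] using hlim.bot_lt
    · rw [vsat_singletonFormula]
      refine ⟨by simpa [mem_vonNeumann] using hlim.bot_lt, fun x hx => ⟨_, hpair x hx,
        ⟨x, hx, rfl⟩, {x}, ?_, by simp [pair], fun y _ => by simp⟩⟩
      rw [mem_vonNeumann, rank_singleton]
      exact hlim.succ_lt (mem_vonNeumann.1 hx)
  refine Filter.mem_of_superset hsub ?_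
  rintro x ⟨α, hα, hsat, hx⟩
  rw [vsat_singletonFormula] at hsat
  obtain ⟨h1, h2⟩ := hsat
  refine ⟨α, hα, by simpa [mem_vonNeumann] using h1, hx, fun β hβ => ?_⟩
  obtain ⟨p, hp, ⟨z, hz, rfl⟩, w, hw, hwp, hwx⟩ := h2 (V_ β) (by simpa using hβ)
  have htr := isTransitive_vonNeumann α
  -- Both elements of the Kuratowski pair contain its first coordinate `z`, and `w` has no element
  -- in `V_α` other than `V_ β`. Hence `z = V_ β`.
  have hzw : z ∈ w := by
    simp only [pair, ZFSet.mem_pair] at hwp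
    rcases hwp with rfl | rfl <;> simp
  have hzx := (hwx z (htr.subset_of_mem hw hzw)).1 hzw
  rw [mem_vonNeumann] at hp
  simp only [pair, rank_pair, rank_singleton, rank_vonNeumann, hzx] at hp
  have := (le_max_right _ _).trans_lt hp
  have := (le_max_right _ _).trans_lt ((Order.lt_succ _).trans this)
  exact (Order.lt_succ _).trans this

/-- Ordinals are coded through ranks, and a symmetric relation by unordered pairs. For `α` closed
under successor, `V_α` contains all pairs of its elements, so it reads the relation correctly. -/
theorem exists_pair_mem_iff {α : Ordinal.{u}} (hα : ∀ β < α, Order.succ β < α)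
    {R : Ordinal.{u} → Ordinal.{u} → Prop} (hsymm : ∀ β γ, R β γ → R γ β) {κ : Ordinal.{u}}
    (hακ : α ≤ κ) {y z : ZFSet.{u}} (hy : y ∈ V_ α) (hz : z ∈ V_ α) :
    (∃ p ∈ V_ α, p ∈ {p | ∃ y ∈ V_ κ, ∃ z ∈ V_ κ, R (rank y) (rank z) ∧ p = {y, z}} ∧
      ∀ w ∈ V_ α, (w ∈ p ↔ w = y ∨ w = z)) ↔ R (rank y) (rank z) := by
  constructor
  · rintro ⟨_, hp, ⟨y', -, z', -, hR, rfl⟩, hw⟩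
    have htr := isTransitive_vonNeumann α
    have h1 := (hw y hy).2 (.inl rfl)
    have h2 := (hw z hz).2 (.inr rfl)
    have h3 := (hw y' (htr.subset_of_mem hp (by simp))).1 (by simp)
    have h4 := (hw z' (htr.subset_of_mem hp (by simp))).1 (by simp)
    simp only [ZFSet.mem_pair] at h1 h2
    rcases h3 with rfl | rfl <;> rcases h4 with rfl | rfl
    · simp only [or_self] at h2
      rwa [h2]
    · exact hR
    · exact hsymm _ _ hR
    · simp only [or_self] at h1
      rwa [h1]
  · intro h
    refine ⟨{y, z}, ?_, ⟨y, vonNeumann_subset_of_le hακ hy, z, vonNeumann_subset_of_le hακ hz,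
      h, rfl⟩, fun w _ => by simp⟩
    rw [mem_vonNeumann, rank_pair]
    exact max_lt (hα _ (mem_vonNeumann.1 hy)) (hα _ (mem_vonNeumann.1 hz))

/-- If all maximal families of pairwise `R`-unrelated ordinals below `κ` are bounded, then this
reflects to many `α < κ`. -/
theorem bounded_mem_wcFilter {κ : Cardinal.{u}} (h0 : ℵ₀ ≤ κ)
    (R : Ordinal.{u} → Ordinal.{u} → Prop) (hsymm : ∀ β γ, R β γ → R γ β)
    (hR : ∀ X ⊆ Set.Iio κ.ord, X.Pairwise (fun β γ => ¬ R β γ) →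
      (∀ β < κ.ord, ∃ γ ∈ X, R β γ) → ∃ δ < κ.ord, ∀ γ ∈ X, γ < δ) :
    {x : Pk κ κ.ord.ToType | ∃ α < κ.ord, 0 < α ∧ (x : Set κ.ord.ToType) = initialSeg κ α ∧
      ∀ X ⊆ Set.Iio α, X.Pairwise (fun β γ => ¬ R β γ) →
      (∀ β < α, ∃ γ ∈ X, R β γ) → ∃ δ < α, ∀ γ ∈ X, γ < δ} ∈ wcFilter κ := by
  have hlim := isSuccLimit_ord h0
  let A : Set ZFSet.{u} :=
    {p | ∃ y ∈ V_ κ.ord, ∃ z ∈ V_ κ.ord, R (rank y) (rank z) ∧ p = {y, z}}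
  have hsub : reflectionSet κ boundedFormula A ∅ ∈ wcFilter κ := by
    refine Filter.mem_generate_of_mem ⟨boundedFormula, A, ∅, ?_, ?_, ?_, rfl⟩
    · rintro _ ⟨y, hy, z, hz, -, rfl⟩
      rw [mem_vonNeumann] at *
      rw [rank_pair]
      exact max_lt (hlim.succ_lt hy) (hlim.succ_lt hz)
    · simpa [mem_vonNeumann] using hlim.bot_lt
    · rw [vsat_boundedFormula]
      refine ⟨by simpa [mem_vonNeumann] using hlim.bot_lt, fun X => ?_⟩
      by_contra hcon
      rw [not_or, not_or] at hcon
      obtain ⟨h1, h2, h3⟩ := hcon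
      have hpair := fun {y z} => exists_pair_mem_iff (fun β => hlim.succ_lt) hsymm le_rfl
        (y := y) (z := z)
      -- An arbitrary `X` is replaced by the set of ranks of its elements. A bound `δ` on these puts
      -- the relevant part of `X` inside the set `V_ δ`.
      obtain ⟨δ, hδ, hb⟩ := hR (rank '' (X ∩ {y | y ∈ V_ κ.ord}))
        (by rintro _ ⟨y, hy, rfl⟩; exact mem_vonNeumann.1 hy.2)
        (by
          rintro _ ⟨y, hy, rfl⟩ _ ⟨z, hz, rfl⟩ hyz hRyz
          exact h2 ⟨y, hy.2, z, hz.2, hy.1, hz.1, fun h => hyz (h ▸ rfl),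
            (hpair hy.2 hz.2).2 hRyz⟩)
        (fun β hβ => by
          by_contra hcon
          refine h3 ⟨V_ β, by simpa using hβ, fun z hz hzX hp => hcon ⟨_, ⟨z, ⟨hzX, hz⟩, rfl⟩, ?_⟩⟩
          simpa using (hpair (by simpa using hβ) hz).1 hp)
      exact h1 ⟨V_ δ, by simpa using hδ, fun y hy hyX =>
        mem_vonNeumann.2 (hb _ ⟨y, ⟨hyX, hy⟩, rfl⟩)⟩
  refine Filter.mem_of_superset (Filter.inter_mem hsub
    (closure_mem_wcFilter h0 Order.succ fun β => hlim.succ_lt)) ?_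
  rintro x ⟨⟨α, hα, hsat, hx⟩, ⟨α', hα', -, hx', hsucc⟩⟩
  obtain rfl : α = α' := initialSeg_injective hα hα' (hx.symm.trans hx')
  rw [vsat_boundedFormula] at hsat
  obtain ⟨h1, h2⟩ := hsat
  refine ⟨α, hα, by simpa [mem_vonNeumann] using h1, hx, fun X hX hXp hXm => ?_⟩
  have hpair := fun {y z} => exists_pair_mem_iff hsucc hsymm hα.le (y := y) (z := z)
  have hmem : ∀ γ ∈ X, V_ γ ∈ V_ α := fun γ hγ => by simpa using hX hγ
  -- Conversely, each ordinal `γ ∈ X` is represented by `V_ γ`, which has rank `γ`.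
  rcases h2 (vonNeumann '' X) with ⟨x, hx, h⟩ | ⟨_, hy, _, hz, ⟨β, hβ, rfl⟩, ⟨γ, hγ, rfl⟩, hne, h⟩ |
    ⟨y, hy, h⟩
  · refine ⟨rank x, mem_vonNeumann.1 hx, fun γ hγ => ?_⟩
    simpa using rank_lt_of_mem (h (V_ γ) (hmem γ hγ) ⟨γ, hγ, rfl⟩)
  · refine absurd ((hpair hy hz).1 h) ?_
    simpa using hXp hβ hγ fun h => hne (h ▸ rfl)
  · obtain ⟨γ, hγ, hRγ⟩ := hXm _ (mem_vonNeumann.1 hy)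
    refine absurd ((hpair hy (hmem γ hγ)).2 ?_) (h _ (hmem γ hγ) ⟨γ, hγ, rfl⟩)
    simpa using hRγ

/-! ### Regular suborders -/

section Orders

variable {P : Type u} [Preorder P]

theorem Compatible.refl (p : P) : Compatible p p := ⟨p, le_rfl, le_rfl⟩

theorem Compatible.symm {p q : P} (h : Compatible p q) : Compatible q p :=
  let ⟨r, hp, hq⟩ := h
  ⟨r, hq, hp⟩

theorem isMaxAntichain_iff {A : Set P} : IsMaxAntichain Compatible A ↔
    IsAntichain Compatible A ∧ ∀ r, ∃ x ∈ A, Compatible r x := by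
  constructor
  · refine fun h => ⟨h.1, fun r => ?_⟩
    by_contra! hr
    have hins : IsAntichain Compatible (insert r A) :=
      h.1.insert (fun b hb _ hc => hr b hb hc.symm) fun b hb _ hc => hr b hb hc
    have := h.2 hins (Set.subset_insert r A)
    exact hr r (this ▸ Set.mem_insert r A) (Compatible.refl r)
  · refine fun h => ⟨h.1, fun t ht hAt => hAt.antisymm fun r hr => ?_⟩
    obtain ⟨x, hx, hrx⟩ := h.2 r
    by_contra hrA
    exact ht hr (hAt hx) (fun h => hrA (h ▸ hx)) hrx

theorem exists_isMaxAntichain {A : Set P} (hA : IsAntichain Compatible A) :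
    ∃ B, A ⊆ B ∧ IsMaxAntichain Compatible B := by
  obtain ⟨B, hAB, hB⟩ := zorn_subset_nonempty {B : Set P | IsAntichain Compatible B}
    (fun c hc hchain hne => ⟨⋃₀ c, (Set.pairwise_sUnion hchain.directedOn).2 fun a ha => hc ha,
      fun s hs => Set.subset_sUnion_of_mem hs⟩) A hA
  exact ⟨B, hAB, hB.prop, fun t ht hBt => hBt.antisymm (hB.le_of_ge ht hBt)⟩

/-- All compatibility is now computed in `P`: once common extensions can be found in `Q`, the two
notions agree on `Q`, and maximality becomes predensity of an antichain. -/
theorem isRegularSuborder_iff {Q : Set P} : IsRegularSuborder Q ↔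
    (∀ p ∈ Q, ∀ q ∈ Q, Compatible p q → ∃ r ∈ Q, r ≤ p ∧ r ≤ q) ∧
    ∀ X ⊆ Q, IsAntichain Compatible X → (∀ q ∈ Q, ∃ x ∈ X, Compatible q x) →
      ∀ p, ∃ x ∈ X, Compatible p x := by
  have hval : ∀ {p q : Q}, Compatible p q → Compatible (p : P) (q : P) :=
    fun ⟨r, hp, hq⟩ => ⟨r, hp, hq⟩
  constructor
  · rintro ⟨h1, h2⟩
    refine ⟨fun p hp q hq hpq => ?_, fun X hXQ hX hmax => ?_⟩
    · obtain ⟨r, hrp, hrq⟩ := not_not.1 (mt (h1 ⟨p, hp⟩ ⟨q, hq⟩) (not_not.2 hpq))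
      exact ⟨r, r.2, hrp, hrq⟩
    · have := isMaxAntichain_iff.1 (h2 (Subtype.val ⁻¹' X) (isMaxAntichain_iff.2
        ⟨fun x hx y hy hxy hc => hX hx hy (fun h => hxy (Subtype.ext h)) (hval hc), fun r => ?_⟩))
      · rw [Subtype.image_preimage_coe, Set.inter_eq_right.2 hXQ] at this
        exact this.2
      · obtain ⟨x, hx, hrx⟩ := hmax r r.2
        exact ⟨⟨x, hXQ hx⟩, hx, not_not.1 (mt (h1 r ⟨x, hXQ hx⟩) (not_not.2 hrx))⟩
  · rintro ⟨h1, h2⟩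
    have hval' : ∀ {p q : Q}, Compatible (p : P) (q : P) → Compatible p q := fun {p q} h => by
      obtain ⟨r, hr, hrp, hrq⟩ := h1 p p.2 q q.2 h
      exact ⟨⟨r, hr⟩, hrp, hrq⟩
    refine ⟨fun p q hpq hc => hpq (hval' hc), fun A hA => ?_⟩
    rw [isMaxAntichain_iff] at hA ⊢
    have hanti : IsAntichain Compatible (Subtype.val '' A) := by
      rintro _ ⟨x, hx, rfl⟩ _ ⟨y, hy, rfl⟩ hxy hc
      exact hA.1 hx hy (fun h => hxy (h ▸ rfl)) (hval' hc)
    refine ⟨hanti, h2 _ (by rintro _ ⟨x, -, rfl⟩; exact x.2) hanti fun q hq => ?_⟩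
    obtain ⟨x, hx, hqx⟩ := hA.2 ⟨q, hq⟩
    exact ⟨x, ⟨x, hx, rfl⟩, hval hqx⟩

theorem IsRegularSuborder.compatible_iff {Q : Set P} (hQ : IsRegularSuborder Q) {p q : Q} :
    Compatible p q ↔ Compatible (p : P) (q : P) :=
  ⟨fun ⟨r, hp, hq⟩ => ⟨r, hp, hq⟩, fun h => not_not.1 (mt (hQ.1 p q) (not_not.2 h))⟩

theorem IsRegularSuborder.trans {Q : Set P} (hQ : IsRegularSuborder Q) {R : Set Q}
    (hR : IsRegularSuborder R) : IsRegularSuborder (Subtype.val '' R : Set P) := by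
  have hQ' := isRegularSuborder_iff.1 hQ
  rw [isRegularSuborder_iff] at hR ⊢
  constructor
  · rintro _ ⟨p, hp, rfl⟩ _ ⟨q, hq, rfl⟩ hpq
    obtain ⟨r, hr, hrp, hrq⟩ := hR.1 p hp q hq (hQ.compatible_iff.2 hpq)
    exact ⟨r, ⟨r, hr, rfl⟩, hrp, hrq⟩
  · intro X hX hanti hmax
    have hXQ : X ⊆ Q := hX.trans (by rintro _ ⟨x, -, rfl⟩; exact x.2)
    refine hQ'.2 X hXQ hanti fun q hq => ?_
    obtain ⟨x, hx, hqx⟩ := hR.2 (Subtype.val ⁻¹' X)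
      (fun x hx => by obtain ⟨y, hy, hyx⟩ := hX hx; rwa [← Subtype.ext hyx])
      (fun x hx y hy hxy hc => hanti hx hy (fun h => hxy (Subtype.ext h))
        (hQ.compatible_iff.1 hc)) (fun r hr => by
        obtain ⟨x, hx, hrx⟩ := hmax r ⟨r, hr, rfl⟩
        exact ⟨⟨x, hXQ hx⟩, hx, hQ.compatible_iff.2 hrx⟩) ⟨q, hq⟩
    exact ⟨x, hx, hQ.compatible_iff.1 hqx⟩

theorem IsRegularSuborder.chainCondition {κ : Cardinal.{u}} {Q : Set P}
    (hQ : IsRegularSuborder Q) (hP : ChainCondition κ P) : ChainCondition κ Q := by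
  intro A hA
  rw [← mk_image_eq (s := A) Subtype.val_injective]
  refine hP _ ?_
  rintro _ ⟨x, hx, rfl⟩ _ ⟨y, hy, rfl⟩ hxy hc
  exact hA hx hy (fun h => hxy (h ▸ rfl)) (hQ.compatible_iff.2 hc)

/-- A regular suborder in which a maximal antichain `B` is predense contains `B`. -/
theorem IsRegularSuborder.antichain_subset {Q B : Set P} (hQ : IsRegularSuborder Q)
    (hB : IsAntichain Compatible B) (h : ∀ q ∈ Q, ∃ b ∈ B, b ∈ Q ∧ Compatible q b) : B ⊆ Q := by
  intro b hb
  obtain ⟨x, hx, hbx⟩ := (isRegularSuborder_iff.1 hQ).2 (B ∩ Q) Set.inter_subset_right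
    (hB.subset Set.inter_subset_left) (fun q hq => by
      obtain ⟨b, hb, hbQ, hqb⟩ := h q hq
      exact ⟨b, ⟨hb, hbQ⟩, hqb⟩) b
  by_contra hbQ
  exact hB hb hx.1 (fun h => hbQ (h ▸ hx.2)) hbx

/-! ### The easy implications -/

theorem IsWeaklyCompact.isKnaster {κ : Cardinal.{u}} (hκ : IsWeaklyCompact κ)
    (hP : ChainCondition κ P) : IsKnaster κ P := by
  classical
  intro S hS
  obtain ⟨e⟩ : Nonempty (κ.ord.ToType ≃ S) := by rw [← Cardinal.eq, mk_ord_toType, hS]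
  let f : κ.ord.ToType → P := fun x => e x
  have hf : Function.Injective f := Subtype.val_injective.comp e.injective
  obtain ⟨H, hH, i, hi⟩ := hκ.2 fun x y => decide (Compatible (f x) (f y))
  have hcard : #(f '' H) = κ := by rw [mk_image_eq hf, hH]
  cases i with
  | true =>
    refine ⟨f '' H, ?_, hcard, ?_⟩
    · rintro _ ⟨x, -, rfl⟩
      exact (e x).2
    · rintro _ ⟨x, hx, rfl⟩ _ ⟨y, hy, rfl⟩
      rcases lt_trichotomy x y with h | h | h
      · exact of_decide_eq_true (hi x hx y hy h)
      · exact h ▸ Compatible.refl _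
      · exact (of_decide_eq_true (hi y hy x hx h)).symm
  | false =>
    refine absurd (hP (f '' H) ?_) hcard.not_lt
    rintro _ ⟨x, hx, rfl⟩ _ ⟨y, hy, rfl⟩ hxy hc
    rcases lt_trichotomy x y with h | h | h
    · exact of_decide_eq_false (hi x hx y hy h) hc
    · exact hxy (h ▸ rfl)
    · exact of_decide_eq_false (hi y hy x hx h) hc.symm

theorem IsKnaster.chainCondition {κ : Cardinal.{u}} (hκ : ℵ₀ < κ) (hP : IsKnaster κ P) :
    ChainCondition κ P := by
  intro A hA
  by_contra! hle
  obtain ⟨S, hSA, hS⟩ := le_mk_iff_exists_subset.1 hle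
  obtain ⟨T, hTS, hT, hc⟩ := hP S hS
  have : Nontrivial T := one_lt_iff_nontrivial.1 (hT ▸ one_lt_aleph0.trans hκ)
  obtain ⟨⟨x, hx⟩, ⟨y, hy⟩, hxy⟩ := exists_pair_ne T
  exact hA (hSA (hTS hx)) (hSA (hTS hy)) (fun h => hxy (Subtype.ext h)) (hc x hx y hy)

theorem isClubPk_closed {κ : Cardinal.{u}} (hr : κ.IsRegular) (h0 : ℵ₀ < κ) {A : Type u}
    (f : A → A) : IsClubPk {a : Pk κ A | ∀ q ∈ (a : Set A), f q ∈ (a : Set A)} where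
  closed := by
    intro D hD _ _ _ x hx q hq
    rw [hx, Set.mem_iUnion₂] at hq ⊢
    obtain ⟨d, hd, hqd⟩ := hq
    exact ⟨d, hd, hD hd q hqd⟩
  cofinal := by
    intro a
    refine ⟨⟨⋃ n : ULift.{u} ℕ, f^[n.down] '' a, ?_⟩, ?_, ?_⟩
    · rw [card_iUnion_lt_iff_forall_of_isRegular hr (by simpa using h0)]
      exact fun n => mk_image_le.trans_lt a.2
    · intro q hq
      simp only [Set.mem_iUnion, Set.mem_image] at hq ⊢
      obtain ⟨n, p, hp, rfl⟩ := hq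
      exact ⟨⟨n.down + 1⟩, p, hp, Function.iterate_succ_apply' f _ _⟩
    · intro q hq
      exact Set.mem_iUnion.2 ⟨⟨0⟩, q, hq, rfl⟩

/-- Extend `A` to a maximal antichain `B` and let `f` choose, for each condition, a compatible
element of `B`. A small regular suborder closed under `f` contains `B`. -/
theorem StationarilyLayered.chainCondition {κ : Cardinal.{u}} (hr : κ.IsRegular) (h0 : ℵ₀ < κ)
    (hP : StationarilyLayered κ P) : ChainCondition κ P := by
  intro A hA
  obtain ⟨B, hAB, hB⟩ := exists_isMaxAntichain hA
  obtain ⟨hB, hmax⟩ := isMaxAntichain_iff.1 hB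
  choose f hfB hf using hmax
  obtain ⟨a, ha, haC⟩ := hP _ (isClubPk_closed hr h0 f)
  have := ha.1.antichain_subset hB fun q hq => ⟨f q, hfB q, haC q hq, hf q⟩
  exact (mk_le_mk_of_subset (hAB.trans this)).trans_lt a.2

end Orders

/-! ### Closure and reflection in terms of the well-order of type `κ` -/

theorem closure_toType_mem_wcFilter {κ : Cardinal.{u}} (h0 : ℵ₀ ≤ κ)
    (g : κ.ord.ToType → κ.ord.ToType) :
    {x : Pk κ κ.ord.ToType | (x : Set κ.ord.ToType).Nonempty ∧ IsLowerSet (x : Set κ.ord.ToType) ∧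
      ∀ d ∈ (x : Set κ.ord.ToType), g d ∈ (x : Set κ.ord.ToType)} ∈ wcFilter κ := by
  classical
  refine Filter.mem_of_superset (closure_mem_wcFilter h0
    (fun β => if h : β < κ.ord then (g (Ordinal.ToType.mk ⟨β, h⟩)).toOrd else 0)
    fun β hβ => ?_) ?_
  · rw [dif_pos hβ]
    exact (g _).toOrd.2
  · rintro x ⟨α, hα, hα0, hx, h⟩
    simp only [Set.mem_ofPred_eq, hx]
    refine ⟨⟨Ordinal.ToType.mk ⟨0, hα0.trans hα⟩, by simpa [mem_initialSeg] using hα0⟩,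
      fun d e hed hd => ?_, fun d hd => ?_⟩
    · rw [← Ordinal.ToType.mk.symm.le_iff_le, ← Subtype.coe_le_coe] at hed
      exact hed.trans_lt hd
    · have h1 : (d.toOrd : Ordinal.{u}) < κ.ord := d.toOrd.2
      have := h d.toOrd hd
      rw [dif_pos h1] at this
      have e : Ordinal.ToType.mk ⟨d.toOrd, h1⟩ = d := Ordinal.ToType.mk.apply_symm_apply d
      rwa [e] at this

theorem bounded_toType_mem_wcFilter {κ : Cardinal.{u}} (h0 : ℵ₀ ≤ κ)
    (R : κ.ord.ToType → κ.ord.ToType → Prop) (hsymm : ∀ β γ, R β γ → R γ β)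
    (hR : ∀ X : Set κ.ord.ToType, X.Pairwise (fun β γ => ¬ R β γ) →
      (∀ β, ∃ γ ∈ X, R β γ) → ∃ δ, ∀ γ ∈ X, γ < δ) :
    {x : Pk κ κ.ord.ToType | ∀ X ⊆ (x : Set κ.ord.ToType), X.Pairwise (fun β γ => ¬ R β γ) →
      (∀ β ∈ (x : Set κ.ord.ToType), ∃ γ ∈ X, R β γ) →
        ∃ δ ∈ (x : Set κ.ord.ToType), ∀ γ ∈ X, γ < δ} ∈ wcFilter κ := by
  have hlt : ∀ d e : κ.ord.ToType, d < e ↔ (d.toOrd : Ordinal.{u}) < e.toOrd := fun d e => by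
    rw [Subtype.coe_lt_coe, Ordinal.ToType.mk.symm.lt_iff_lt]
  let R' : Ordinal.{u} → Ordinal.{u} → Prop := fun β γ =>
    ∃ d e : κ.ord.ToType, (d.toOrd : Ordinal.{u}) = β ∧ (e.toOrd : Ordinal.{u}) = γ ∧ R d e
  have hR' : ∀ d e : κ.ord.ToType, R' d.toOrd e.toOrd ↔ R d e := fun d e => by
    constructor
    · rintro ⟨d', e', hd, he, h⟩
      rw [Subtype.coe_inj, Ordinal.ToType.mk.symm.injective.eq_iff] at hd he
      rwa [hd, he] at h
    · exact fun h => ⟨d, e, rfl, rfl, h⟩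
  have hmk : ∀ β < κ.ord, ∃ d : κ.ord.ToType, (d.toOrd : Ordinal.{u}) = β := fun β hβ =>
    ⟨Ordinal.ToType.mk ⟨β, hβ⟩, by simp⟩
  refine Filter.mem_of_superset (bounded_mem_wcFilter h0 R'
    (fun β γ ⟨d, e, hd, he, h⟩ => ⟨e, d, he, hd, hsymm _ _ h⟩) fun X hX hXp hXm => ?_) ?_
  · obtain ⟨δ, hδ⟩ := hR {d | (d.toOrd : Ordinal.{u}) ∈ X}
      (fun d hd e he hde h => hXp hd he
        (fun h => hde (Ordinal.ToType.mk.symm.injective (Subtype.ext h))) ((hR' d e).2 h))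
      (fun d => by
        obtain ⟨γ, hγ, h⟩ := hXm d.toOrd d.toOrd.2
        obtain ⟨e, rfl⟩ := hmk γ (hX hγ)
        exact ⟨e, hγ, (hR' d e).1 h⟩)
    refine ⟨δ.toOrd, δ.toOrd.2, fun γ hγ => ?_⟩
    obtain ⟨e, rfl⟩ := hmk γ (hX hγ)
    exact (hlt _ _).1 (hδ e hγ)
  · rintro x ⟨α, hα, hα0, hx, h⟩ X hX hXp hXm
    obtain ⟨δ, hδ, h⟩ := h ((fun d => (d.toOrd : Ordinal.{u})) '' X)
      (by rintro _ ⟨d, hd, rfl⟩; have := hX hd; rwa [hx] at this)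
      (by
        rintro _ ⟨d, hd, rfl⟩ _ ⟨e, he, rfl⟩ hde h
        exact hXp hd he (fun h => hde (h ▸ rfl)) ((hR' d e).1 h))
      (fun β hβ => by
        obtain ⟨d, rfl⟩ := hmk β (hβ.trans hα)
        obtain ⟨e, he, h⟩ := hXm d (by rw [hx]; exact hβ)
        exact ⟨_, ⟨e, he, rfl⟩, (hR' d e).2 h⟩)
    obtain ⟨d, rfl⟩ := hmk δ (hδ.trans hα)
    exact ⟨d, by rw [hx]; exact hδ, fun γ hγ => (hlt _ _).2 (h _ ⟨γ, hγ, rfl⟩)⟩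

/-! ### Chains of small suborders -/

section Layers

variable {P : Type u} [Preorder P]

/-- Every small set is contained in a small set that contains witnesses for the compatibility of
its elements and for subsets that are not predense. -/
theorem exists_witness_closure {κ : Cardinal.{u}} (hκ : κ.IsInaccessible) (a : Pk κ P) :
    ∃ b : Pk κ P, a ≤ b ∧
      (∀ p ∈ (a : Set P), ∀ q ∈ (a : Set P), Compatible p q →
        ∃ r ∈ (b : Set P), r ≤ p ∧ r ≤ q) ∧
      ∀ X ⊆ (a : Set P), (∃ r, ∀ x ∈ X, ¬ Compatible r x) →
        ∃ r ∈ (b : Set P), ∀ x ∈ X, ¬ Compatible r x := by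
  have h0 := hκ.aleph0_lt.le
  obtain ⟨a, ha⟩ := a
  choose w hw using fun pq : {pq : a × a // Compatible (pq.1 : P) (pq.2 : P)} => pq.2
  choose g hg using fun X : {X : Set a // ∃ r, ∀ x ∈ X, ¬ Compatible r (x : P)} => X.2
  have hcard : #(a ∪ (Set.range w ∪ Set.range g) : Set P) < κ := by
    refine (mk_union_le _ _).trans_lt (add_lt_of_lt h0 ha ?_)
    refine (mk_union_le _ _).trans_lt (add_lt_of_lt h0 ?_ ?_)
    · refine mk_range_le.trans_lt ((mk_subtype_le _).trans_lt ?_)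
      rw [mk_prod, lift_id]
      exact mul_lt_of_lt h0 ha ha
    · refine mk_range_le.trans_lt ((mk_subtype_le _).trans_lt ?_)
      rw [mk_set]
      -- A witness is added for each subset of `a`, which is where the strong limit property is
      -- needed.
      exact hκ.isStrongPrelimit ha
  refine ⟨⟨_, hcard⟩, Set.subset_union_left, fun p hp q hq h => ?_, fun X hX ⟨r, hr⟩ => ?_⟩
  · exact ⟨w ⟨(⟨p, hp⟩, ⟨q, hq⟩), h⟩, .inr (.inl ⟨_, rfl⟩), hw ⟨(⟨p, hp⟩, ⟨q, hq⟩), h⟩⟩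
  · have hX' : ∃ r, ∀ x ∈ (Subtype.val ⁻¹' X : Set a), ¬ Compatible r (x : P) :=
      ⟨r, fun x hx => hr x hx⟩
    exact ⟨g ⟨_, hX'⟩, .inr (.inr ⟨_, rfl⟩), fun x hx => hg ⟨_, hX'⟩ ⟨x, hX hx⟩ hx⟩

/-- A chain of length `κ` of small sets in a club whose union is a regular suborder. -/
theorem exists_regular_chain {κ : Cardinal.{u}} (hκ : κ.IsInaccessible) (hP : ChainCondition κ P)
    {C : Set (Pk κ P)} (hC : ∀ a : Pk κ P, ∃ c ∈ C, a ≤ c) (e : κ.ord.ToType → Pk κ P) :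
    ∃ a : κ.ord.ToType → Pk κ P, (∀ ξ, a ξ ∈ C) ∧ Monotone a ∧ (∀ η ξ, η < ξ → e η ≤ a ξ) ∧
      IsRegularSuborder (⋃ ξ, (a ξ : Set P)) := by
  have hr := hκ.isRegular
  choose N hN1 hN2 hN3 using exists_witness_closure (P := P) hκ
  choose c hcC hc using hC
  have hcard : ∀ (ξ : κ.ord.ToType) (f : Set.Iio ξ → Pk κ P),
      #(⋃ η : Set.Iio ξ, ((N (f η) : Set P) ∪ e η) : Set P) < κ := fun ξ f => by
    rw [card_iUnion_lt_iff_forall_of_isRegular hr (mk_Iio_toType_lt ξ)]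
    exact fun η => (mk_union_le _ _).trans_lt (add_lt_of_lt hr.aleph0_le (N _).2 (e _).2)
  let a : κ.ord.ToType → Pk κ P := WellFoundedLT.fix fun ξ ih =>
    c ⟨_, hcard ξ fun η => ih η.1 η.2⟩
  have ha : ∀ ξ, a ξ = c ⟨_, hcard ξ fun η => a η.1⟩ := fun ξ => WellFoundedLT.fix_eq _ ξ
  have hsub : ∀ η ξ, η < ξ → (N (a η) : Set P) ∪ e η ⊆ a ξ := fun η ξ h => by
    rw [ha ξ]
    exact (Set.subset_iUnion (fun η : Set.Iio ξ => (N (a η.1) : Set P) ∪ e η) ⟨η, h⟩).trans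
      (hc ⟨_, hcard ξ fun η => a η.1⟩ : _)
  have hmono : Monotone a := monotone_iff_forall_lt.2 fun η ξ h =>
    (hN1 (a η)).trans (Set.subset_union_left.trans (hsub η ξ h))
  refine ⟨a, fun ξ => by rw [ha]; exact hcC _, hmono,
    fun η ξ h => Set.subset_union_right.trans (hsub η ξ h), ?_⟩
  have hNsub : ∀ ξ, (N (a ξ) : Set P) ⊆ ⋃ ξ, (a ξ : Set P) := fun ξ => by
    obtain ⟨ξ', h⟩ := exists_gt hr ξ
    exact (Set.subset_union_left.trans (hsub ξ ξ' h)).trans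
      (Set.subset_iUnion (fun ξ => (a ξ : Set P)) ξ')
  rw [isRegularSuborder_iff]
  constructor
  · intro p hp q hq hpq
    obtain ⟨ξ, hp⟩ := Set.mem_iUnion.1 hp
    obtain ⟨η, hq⟩ := Set.mem_iUnion.1 hq
    obtain ⟨r, hr, h⟩ := hN2 (a (max ξ η)) p (hmono (le_max_left _ _) hp) q
      (hmono (le_max_right _ _) hq) hpq
    exact ⟨r, hNsub _ hr, h⟩
  · intro X hX hanti hmax
    have hX' : ∀ x : X, ∃ ξ, (x : P) ∈ (a ξ : Set P) := fun x => Set.mem_iUnion.1 (hX x.2)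
    choose i hi using hX'
    -- By the chain condition `X` is small, so it is contained in one stage `a d`. If `X` were not
    -- predense in `P`, the next stage would contain a witness, against its predensity in the union.
    obtain ⟨d, hd⟩ := exists_bound hr (hP X hanti) i
    by_contra! hcon
    obtain ⟨r, hr, hrX⟩ := hN3 (a d) X (fun x hx => hmono (hd ⟨x, hx⟩).le (hi ⟨x, hx⟩)) hcon
    obtain ⟨x, hx, hrx⟩ := hmax r (hNsub d hr)
    exact hrX x hx hrx

/-! ### From the chain condition to layering, and back -/

theorem ChainCondition.reg_mem_wcFilter {κ : Cardinal.{u}} (hκ : κ.IsInaccessible)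
    (hP : ChainCondition κ P) {s : κ.ord.ToType → P} (hs : Function.Surjective s) :
    {x : Pk κ κ.ord.ToType | s '' (x : Set κ.ord.ToType) ∈ Reg κ P} ∈ wcFilter κ := by
  have hr := hκ.isRegular
  have h0 := hr.aleph0_le
  choose N hN1 hN2 hN3 using exists_witness_closure (P := P) hκ
  let seg : κ.ord.ToType → Pk κ P := fun d =>
    ⟨s '' Set.Iio d, mk_image_le.trans_lt (mk_Iio_toType_lt d)⟩
  have hG : ∀ d, ∃ d', ∀ q ∈ (N (seg d) : Set P), ∃ e < d', s e = q := fun d => by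
    obtain ⟨d', hd'⟩ := exists_bound hr (N (seg d)).2 fun q => Function.surjInv hs q.1
    -- Regularity bounds the indices of the fewer than `κ` many witnesses for `s '' Set.Iio d`.
    exact ⟨d', fun q hq => ⟨_, hd' ⟨q, hq⟩, Function.surjInv_eq hs q⟩⟩
  choose G hG using hG
  choose succ hsucc using exists_gt hr
  have hbdd := bounded_toType_mem_wcFilter h0 (fun d e => Compatible (s d) (s e))
    (fun _ _ => Compatible.symm) fun X hX _ => by
      have hinj : Set.InjOn s X := fun d hd e he h => by
        by_contra hne
        exact hX hd he hne (h ▸ Compatible.refl _)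
      have hcard : #(s '' X) < κ := hP _ (by
        rintro _ ⟨d, hd, rfl⟩ _ ⟨e, he, rfl⟩ hde
        exact hX hd he fun h => hde (h ▸ rfl))
      rw [mk_image_eq_of_injOn _ _ hinj] at hcard
      obtain ⟨δ, hδ⟩ := exists_bound hr hcard Subtype.val
      exact ⟨δ, fun γ hγ => hδ ⟨γ, hγ⟩⟩
  filter_upwards [hbdd, closure_toType_mem_wcFilter h0 G, closure_toType_mem_wcFilter h0 succ]
    with x hbdd ⟨_, hlow, hxG⟩ ⟨_, _, hxs⟩
  refine ⟨isRegularSuborder_iff.2 ⟨?_, fun X hX hanti hmax => ?_⟩, mk_image_le.trans_lt x.2⟩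
  · rintro _ ⟨d, hd, rfl⟩ _ ⟨e, he, rfl⟩ hc
    have hm : max d e ∈ (x : Set κ.ord.ToType) := by
      rcases max_choice d e with h | h <;> rwa [h]
    have hlt := hsucc (max d e)
    obtain ⟨r, hr, hrde⟩ := hN2 (seg (succ (max d e))) _ ⟨d, (le_max_left _ _).trans_lt hlt, rfl⟩ _
      ⟨e, (le_max_right _ _).trans_lt hlt, rfl⟩ hc
    obtain ⟨d', hd', rfl⟩ := hG _ r hr
    exact ⟨_, ⟨d', hlow hd'.le (hxG _ (hxs _ hm)), rfl⟩, hrde⟩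
  -- Since `s` need not be injective, one index in `x` is chosen per element of `X`. Distinct
  -- indices then name incompatible conditions, so reflection bounds them by some `δ ∈ x`, and
  -- witnesses for `seg δ` stay inside `s '' x`.
  · choose i hix hi using fun y : X => hX y.2
    obtain ⟨δ, hδ, hb⟩ := hbdd (Set.range i) (by rintro _ ⟨y, rfl⟩; exact hix y)
      (by
        rintro _ ⟨y, rfl⟩ _ ⟨z, rfl⟩ hyz hc
        rw [hi, hi] at hc
        exact hanti y.2 z.2 (fun h => hyz (by rw [Subtype.ext h])) hc)
      (fun β hβ => by
        obtain ⟨y, hy, h⟩ := hmax (s β) ⟨β, hβ, rfl⟩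
        exact ⟨_, ⟨⟨y, hy⟩, rfl⟩, by rwa [hi]⟩)
    by_contra! hcon
    obtain ⟨r, hr, hrX⟩ := hN3 (seg δ) X (fun y hy => ⟨i ⟨y, hy⟩, hb _ ⟨_, rfl⟩, hi _⟩) hcon
    obtain ⟨d', hd', rfl⟩ := hG _ r hr
    obtain ⟨y, hy, h⟩ := hmax _ ⟨d', hlow hd'.le (hxG _ hδ), rfl⟩
    exact hrX y hy h

theorem exists_surjective_toType {κ : Cardinal.{u}} {Q : Type u} [Nonempty Q] (hQ : #Q ≤ κ) :
    ∃ s : κ.ord.ToType → Q, Function.Surjective s := by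
  obtain ⟨f⟩ : Nonempty (Q ↪ κ.ord.ToType) := by rw [← Cardinal.le_def, mk_ord_toType]; exact hQ
  exact ⟨Function.invFun f, Function.invFun_surjective f.injective⟩

theorem ChainCondition.completelyFLayered {κ : Cardinal.{u}} (hκ : κ.IsInaccessible)
    (hP : ChainCondition κ P) : CompletelyFLayered (wcFilter κ) P := by
  have h0 := hκ.aleph0_lt.le
  refine ⟨fun S hS => ?_, fun Q hQ hcard => ⟨hcard, fun s hs =>
    (hQ.chainCondition hP).reg_mem_wcFilter hκ hs⟩⟩
  obtain ⟨f⟩ : Nonempty (S ↪ κ.ord.ToType) := by rw [← Cardinal.le_def, mk_ord_toType]; exact hS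
  -- `S` is fed into the chain at most one element per stage, keeping each stage small.
  have hone : ∀ d, #(Subtype.val '' (f ⁻¹' {d}) : Set P) < κ := fun d => by
    refine mk_image_le.trans_lt (lt_of_le_of_lt ?_ (one_lt_aleph0.trans hκ.aleph0_lt))
    rw [mk_le_one_iff_set_subsingleton]
    exact Set.subsingleton_singleton.preimage f.injective
  obtain ⟨a, -, -, ha, hreg⟩ := exists_regular_chain hκ hP (C := Set.univ)
    (fun a => ⟨a, trivial, le_rfl⟩) fun d => ⟨_, hone d⟩
  refine ⟨_, fun p hp => ?_, hreg, ?_⟩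
  · obtain ⟨ξ, hξ⟩ := exists_gt hκ.isRegular (f ⟨p, hp⟩)
    exact Set.mem_iUnion.2 ⟨ξ, ha _ ξ hξ ⟨⟨p, hp⟩, rfl, rfl⟩⟩
  · refine (mk_iUnion_le_sum_mk).trans ((sum_le_sum _ (fun _ => κ) fun ξ => (a ξ).2.le).trans ?_)
    simpa using mul_le_of_le h0 le_rfl le_rfl

/-- Properness of the filter yields some `x` with `s '' x` regular and closed under choosing
compatible elements of a maximal antichain. It thus contains an antichain of size `κ` while having
size less than `κ`. -/
theorem IsWeaklyCompact.chainCondition_of_layered {κ : Cardinal.{u}} (hκ : IsWeaklyCompact κ)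
    (hP : CompletelyFLayered (wcFilter κ) P) : ChainCondition κ P := by
  have := hκ.wcFilter_neBot
  intro A hA
  by_contra! hle
  obtain ⟨S, hSA, hS⟩ := le_mk_iff_exists_subset.1 hle
  obtain ⟨Q, hSQ, hQ, hcard⟩ := hP.1 S hS.le
  obtain ⟨-, hlay⟩ := hP.2 Q hQ hcard
  obtain ⟨B, hAB, hB⟩ := exists_isMaxAntichain (A := (Subtype.val ⁻¹' S : Set Q))
    fun x hx y hy hxy hc => hA (hSA hx) (hSA hy) (fun h => hxy (Subtype.ext h))
      (hQ.compatible_iff.1 hc)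
  obtain ⟨hB, hmax⟩ := isMaxAntichain_iff.1 hB
  have hSne : S.Nonempty := by
    rw [← Set.nonempty_coe_sort, ← mk_ne_zero_iff, hS]
    exact (aleph0_pos.trans hκ.1).ne'
  have : Nonempty Q := ⟨⟨_, hSQ hSne.some_mem⟩⟩
  obtain ⟨s, hs⟩ := exists_surjective_toType hcard
  choose f hfB hf using hmax
  obtain ⟨x, hx, -, -, hxf⟩ := Filter.nonempty_of_mem (Filter.inter_mem (hlay s hs)
    (closure_toType_mem_wcFilter hκ.1.le fun d => Function.surjInv hs (f (s d))))
  have hBx := hx.1.antichain_subset hB (by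
    rintro _ ⟨d, hd, rfl⟩
    exact ⟨_, hfB (s d), ⟨_, hxf d hd, Function.surjInv_eq hs _⟩, hf _⟩)
  have h1 := (mk_le_mk_of_subset (hAB.trans hBx)).trans_lt hx.2
  rw [← mk_image_eq (s := (Subtype.val ⁻¹' S : Set Q)) Subtype.val_injective,
    Subtype.image_preimage_coe, Set.inter_eq_right.2 hSQ, hS] at h1
  exact lt_irrefl _ h1

/-- Build a chain of length `κ` inside the club with regular union `Q`. For many `x`, the set `s ''
x` is regular in `Q`, hence in `P`, and is also the union of the `a ξ` with `ξ ∈ x`, so it lies in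
the club. -/
theorem IsWeaklyCompact.stationarilyLayered {κ : Cardinal.{u}} (hκ : IsWeaklyCompact κ)
    (hP : ChainCondition κ P) : StationarilyLayered κ P := by
  have hin := hκ.isInaccessible
  have hr := hκ.isRegular
  have := hκ.wcFilter_neBot
  intro C hC
  obtain ⟨a, haC, hmono, -, hreg⟩ := exists_regular_chain hin hP hC.cofinal
    fun _ => ⟨∅, by simpa using aleph0_pos.trans hκ.1⟩
  set Q := ⋃ ξ, (a ξ : Set P) with hQ
  have hsub : ∀ ξ, (a ξ : Set P) ⊆ Q := fun ξ => Set.subset_iUnion (fun ξ => (a ξ : Set P)) ξ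
  -- An empty `Q` admits no surjection from `κ`; each stage of the chain then equals `Q`.
  rcases isEmpty_or_nonempty Q with hempty | hne
  · obtain ⟨d⟩ : Nonempty κ.ord.ToType := nonempty_ord_toType (aleph0_pos.trans hκ.1).ne'
    have : (a d : Set P) = Q := by
      rw [Set.isEmpty_coe_sort] at hempty
      rw [hempty, ← Set.subset_empty_iff, ← hempty]
      exact hsub d
    exact ⟨a d, ⟨by rw [this]; exact hreg, (a d).2⟩, haC d⟩
  · have hcard : #Q ≤ κ := by
      refine (mk_iUnion_le_sum_mk).trans
        ((sum_le_sum _ (fun _ => κ) fun ξ => (a ξ).2.le).trans ?_)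
      simpa using mul_le_of_le hκ.1.le le_rfl le_rfl
    obtain ⟨s, hs⟩ := exists_surjective_toType hcard
    choose g hg using fun d => Set.mem_iUnion.1 (s d).2
    have hG : ∀ ξ, ∃ d, ∀ p ∈ (a ξ : Set P), ∃ e < d, (s e : P) = p := fun ξ => by
      obtain ⟨d, hd⟩ := exists_bound hr (a ξ).2 fun p =>
        Function.surjInv hs ⟨p.1, hsub ξ p.2⟩
      exact ⟨d, fun p hp => ⟨_, hd ⟨p, hp⟩, by rw [Function.surjInv_eq hs]⟩⟩
    choose G hG using hG
    obtain ⟨x, hx, ⟨hxne, hlow, hxg⟩, -, -, hxG⟩ :=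
      Filter.nonempty_of_mem (Filter.inter_mem
        ((hreg.chainCondition hP).reg_mem_wcFilter hin hs) (Filter.inter_mem
        (closure_toType_mem_wcFilter hκ.1.le g) (closure_toType_mem_wcFilter hκ.1.le G)))
    let y : Pk κ P := ⟨Subtype.val '' (s '' (x : Set κ.ord.ToType)),
      mk_image_le.trans_lt (mk_image_le.trans_lt x.2)⟩
    refine ⟨y, ⟨hreg.trans hx.1, y.2⟩, hC.closed (a '' (x : Set κ.ord.ToType)) ?_ (hxne.image a) ?_
      (mk_image_le.trans_lt x.2) y ?_⟩
    · rintro _ ⟨ξ, -, rfl⟩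
      exact haC ξ
    · rintro _ ⟨ξ, -, rfl⟩ _ ⟨η, -, rfl⟩ -
      exact (le_total ξ η).imp (fun h => hmono h) fun h => hmono h
    -- Closure of `x` under `g` places `s '' x` inside the union of the `a ξ`; closure under `G`
    -- gives the reverse inclusion.
    · rw [Set.biUnion_image]
      ext p
      simp only [y, Set.mem_image, Set.mem_iUnion, exists_prop]
      constructor
      · rintro ⟨_, ⟨d, hd, rfl⟩, rfl⟩
        exact ⟨g d, hxg d hd, hg d⟩
      · rintro ⟨ξ, hξ, hp⟩
        obtain ⟨e, he, rfl⟩ := hG ξ p hp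
        exact ⟨_, ⟨e, hlow he.le (hxG ξ hξ), rfl⟩, rfl⟩

end Layers

end Layering

theorem theorem1p4 (κ : Cardinal.{u}) (hκ : Layering.IsWeaklyCompact κ)
    (P : Type u) [Preorder P] :
    List.TFAE [
      Layering.ChainCondition κ P,
      Layering.IsKnaster κ P,
      Layering.StationarilyLayered κ P,
      Layering.CompletelyFLayered (Layering.wcFilter κ) P] := by
  tfae_have 1 → 2 := hκ.isKnaster
  tfae_have 2 → 1 := fun h => h.chainCondition hκ.1
  tfae_have 1 → 3 := hκ.stationarilyLayered
  tfae_have 3 → 1 := fun h => h.chainCondition hκ.isRegular hκ.1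
  tfae_have 1 → 4 := fun h => h.completelyFLayered hκ.isInaccessible
  tfae_have 4 → 1 := hκ.chainCondition_of_layered
  tfae_finish
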